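/- **Definitions.** A *translation surface* is a closed connected surface $X$ with a finite set $\Sigma$ of singular points, an atlas of charts to $\mathbb C$ on $X\setminus\Sigma$ whose transition maps are translations, and at each $x\in\Sigma$ a neighbourhood that is, compatibly with the charts, a disc around the apex of a Euclidean cone of some angle $2\pi(\kappa+1)$, $\kappa\ge 0$ an integer. For $A\in SL(2,\mathbb R)$, $AX$ is the translation surface obtained by composing all charts with the linear action of $A$ on $\mathbb C=\mathbb R^2$. An *oriented saddle connection* $s$ is an oriented straight segment from a singular point $i(s)$ to a singular point $t(s)$ (possibly equal) with no singular point in its interior; its holonomy vector is its displacement in the charts, and its length $\ell(s)$ is the Euclidean norm of that vector. An *oriented saddle connection path* is a sequence $\underline s=s_1\cdots s_N$ ($N\ge1$) of oriented saddle connections with $t(s_i)=i(s_{i+1})$ such that the angles between $s_i$ and $s_{i+1}$ at this point are at least $\pi$ on both sides; its length is $\ell(\underline s)=\sum_i\ell(s_i)$. A *singular connection* is a non-empty finite sequence of oriented saddle connections $s_1\cdots s_r$ such that, for $1\le i<r$, $t(s_i)=i(s_{i+1})$ and the angle from $s_i$ to $s_{i+1}$, moving clockwise around $t(s_i)$, is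 equal to $\pi$. A path $\underline s$ *decomposes into $m$ maximal singular connections* if it has a unique decomposition $\underline s=e_1\cdots e_{m'}$ into singular connections such that no $e_ie_{i+1}$ is a singular connection, and $m'=m$. **Lemma 3.1.** Let $k,n\ge1$ and let $X_0$ be a translation surface of area $1$ with exactly $n$ singular points, all of cone angle $2\pi(k+1)$. Suppose that $X_0$ is square-tiled with singularities precisely at the vertices: it is tiled by finitely many equal squares with sides parallel to the coordinate axes, glued by translations, right sides to left sides and top sides to bottom sides, and $\Sigma$ is exactly the set of vertices of the squares. Put $$\Lambda=\left\{\left(\frac{a}{\sqrt{n(k+1)}},\frac{b}{\sqrt{n(k+1)}}\right):(a,b)\in\mathbb Z^2\setminus\{(0,0)\}\right\}.$$ Let $A\in SL(2,\mathbb R)$, let $A(\Lambda)$ be the image of $\Lambda$ under $A$, and let $m\ge1$. Then there is a bijection between the set of oriented saddle connection paths on $AX_0$ that decompose into $m$ maximal singular connections and the set of tuples $$(x;\,j_1,v_1;\,j_2,v_2;\,\dots;\,j_m,v_m)\in\Sigma\times\bigl(\mathbb Z/(k+1)\mathbb Z\times A(\Lambda)\bigr)\times\bigl(\mathbb Z/k\mathbb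 Z\times A(\Lambda)\bigr)^{m-1}$$ such that, if $\underline s=e_1\cdots e_m$ corresponds to this tuple, then $x=i(\underline s)$ is the initial point of $\underline s$, $v_i$ is the holonomy vector of $e_i$ (the sum of the holonomy vectors of its saddle connections) for each $i$, and $$\ell(\underline s)=\sum_{i=1}^m\|v_i\|,$$ where $\|\cdot\|$ is the Euclidean norm. -/

import Mathlib

open Filter Topology

/-- The linear action of `A ∈ SL(2, ℝ)` on the plane `ℂ = ℝ²`. -/
noncomputable def planeMap (A : Matrix.SpecialLinearGroup (Fin 2) ℝ) : ℂ ≃L[ℝ] ℂ :=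
  LinearEquiv.toContinuousLinearEquiv
    { toFun := fun z => ⟨A 0 0 * z.re + A 0 1 * z.im, A 1 0 * z.re + A 1 1 * z.im⟩
      invFun := fun z => ⟨A 1 1 * z.re - A 0 1 * z.im, - A 1 0 * z.re + A 0 0 * z.im⟩
      map_add' := fun z w => by
        apply Complex.ext <;> simp <;> ring
      map_smul' := fun c z => by
        apply Complex.ext <;> simp <;> ring
      left_inv := fun z => by
        have h := A.det_coe
        rw [Matrix.det_fin_two] at h
        apply Complex.ext
        · simp only; linear_combination z.re * h
        · simp only; linear_combination z.im * h
      right_inv := fun z => by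
        have h := A.det_coe
        rw [Matrix.det_fin_two] at h
        apply Complex.ext
        · simp only; linear_combination z.re * h
        · simp only; linear_combination z.im * h }

/-- Polar coordinates around `x`, on a space with a set `sing` of singular points and an atlas of
plane-valued charts on the complement: `P (r, θ)`, for `0 ≤ r < ε`, is a homeomorphism
from the disc of radius `ε` in the cone of angle `2π(k+1)` (that is, `2k+2` half planes glued
cyclically along half lines) onto a neighbourhood of `x`, which takes the apex to `x` and is, away
from the apex, a translation in the charts; the angle `θ` is defined modulo `2π(k+1)` and
increases anticlockwise. -/
structure IsPolarChart {X : Type*} [TopologicalSpace X] (sing : Set X)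
    (atlas : Set (OpenPartialHomeomorph X ℂ)) (x : X) (k : ℕ) (ε : ℝ) (P : ℝ × ℝ → X) :
    Prop where
  pos : 0 < ε
  apex : ∀ θ, P (0, θ) = x
  continuousOn : ContinuousOn P (Set.Ico 0 ε ×ˢ Set.univ)
  eq_iff : ∀ r ∈ Set.Ioo 0 ε, ∀ r' ∈ Set.Ioo 0 ε, ∀ θ θ' : ℝ,
    P (r, θ) = P (r', θ') ↔ r = r' ∧ ∃ j : ℤ, θ' = θ + j * (2 * Real.pi * (k + 1))
  nhds : ∀ δ ∈ Set.Ioc 0 ε, P '' (Set.Ico 0 δ ×ˢ Set.univ) ∈ 𝓝 x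
  regular : ∀ r ∈ Set.Ioo 0 ε, ∀ θ, P (r, θ) ∉ sing
  translation : ∀ r ∈ Set.Ioo 0 ε, ∀ θ, ∀ φ ∈ atlas, P (r, θ) ∈ φ.source →
    ∀ᶠ q in 𝓝 (r, θ), φ (P q) - φ (P (r, θ)) =
      q.1 * Complex.exp (q.2 * Complex.I) - r * Complex.exp (θ * Complex.I)

/-- A translation surface on the space `X`: a closed connected surface with a finite set of
singular points, an atlas on the complement whose transition maps are (locally)
translations, and a cone neighbourhood at each singular point. -/
structure TranslationSurface (X : Type*) [TopologicalSpace X] where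
  compact : CompactSpace X
  hausdorff : T2Space X
  connected : ConnectedSpace X
  /-- the singularity set -/
  sing : Set X
  finite_sing : sing.Finite
  /-- the charts -/
  atlas : Set (OpenPartialHomeomorph X ℂ)
  source_subset : ∀ φ ∈ atlas, φ.source ⊆ singᶜ
  cover : ∀ x ∉ sing, ∃ φ ∈ atlas, x ∈ φ.source
  transition : ∀ φ ∈ atlas, ∀ ψ ∈ atlas, ∀ x ∈ φ.source ∩ ψ.source,
    ∀ᶠ y in 𝓝 x, ψ y - ψ x = φ y - φ x
  cone : ∀ x ∈ sing, ∃ (k : ℕ) (ε : ℝ) (P : ℝ × ℝ → X), IsPolarChart sing atlas x k ε P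

theorem planeMap_inv_apply (A : Matrix.SpecialLinearGroup (Fin 2) ℝ) (z : ℂ) :
    planeMap A (planeMap A⁻¹ z) = z := by
  have h := A.det_coe
  rw [Matrix.det_fin_two] at h
  apply Complex.ext
  · simp [planeMap, Matrix.SpecialLinearGroup.SL2_inv_expl]
    linear_combination z.re * h
  · simp [planeMap, Matrix.SpecialLinearGroup.SL2_inv_expl]
    linear_combination z.im * h

/-- An orientation preserving linear map of the plane in polar coordinates: its
action on directions lifts to a homeomorphism of the line of angles. -/
theorem exists_angle_lift (A : Matrix.SpecialLinearGroup (Fin 2) ℝ) :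
    ∃ Θ : ℝ → ℝ, Continuous Θ ∧ Function.Bijective Θ ∧
      (∀ (θ : ℝ) (j : ℤ), Θ (θ + j * (2 * Real.pi)) = Θ θ + j * (2 * Real.pi)) ∧
      ∀ θ : ℝ, planeMap A (Complex.exp (θ * Complex.I)) =
        ‖planeMap A (Complex.exp (θ * Complex.I))‖ * Complex.exp (Θ θ * Complex.I) := by
  have hdet := A.det_coe
  rw [Matrix.det_fin_two] at hdet
  set α : ℂ := ⟨(A 0 0 + A 1 1) / 2, (A 1 0 - A 0 1) / 2⟩ with hα
  set β : ℂ := ⟨(A 0 0 - A 1 1) / 2, (A 1 0 + A 0 1) / 2⟩ with hβ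
  have hB : ∀ z, planeMap A z = α * z + β * (starRingEnd ℂ) z := by
    intro z
    apply Complex.ext <;> simp [planeMap, hα, hβ] <;> ring
  have hn : Complex.normSq β + 1 = Complex.normSq α := by
    simp only [Complex.normSq_apply, hα, hβ]
    linear_combination (-1 : ℝ) * hdet
  have hα0 : α ≠ 0 := by
    intro h
    rw [h, map_zero] at hn
    linarith [Complex.normSq_nonneg β]
  have hlt : ‖β / α‖ < 1 := by
    rw [norm_div, div_lt_one (norm_pos_iff.2 hα0)]
    rw [Complex.normSq_eq_norm_sq, Complex.normSq_eq_norm_sq] at hn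
    exact lt_of_pow_lt_pow_left₀ 2 (norm_nonneg _) (by linarith)
  -- the factor that twists directions stays in the right half plane
  set w : ℝ → ℂ := fun θ => 1 + β / α * Complex.exp (-(2 * θ * Complex.I)) with hw
  have hwc : Continuous w := by fun_prop
  have hwre : ∀ θ, 0 < (w θ).re := by
    intro θ
    have h1 : ‖β / α * Complex.exp (-(2 * θ * Complex.I))‖ < 1 := by
      rw [norm_mul, Complex.norm_exp]
      simpa using hlt
    have h2 := Complex.abs_re_le_norm (β / α * Complex.exp (-(2 * θ * Complex.I)))
    have h3 := (abs_lt.1 (lt_of_le_of_lt h2 h1)).1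
    simp only [hw, Complex.add_re, Complex.one_re]
    linarith
  have hfac : ∀ θ : ℝ, planeMap A (Complex.exp (θ * Complex.I)) =
      α * Complex.exp (θ * Complex.I) * w θ := by
    intro θ
    have h1 : (starRingEnd ℂ) (Complex.exp (θ * Complex.I)) =
        Complex.exp (θ * Complex.I) * Complex.exp (-(2 * θ * Complex.I)) := by
      rw [← Complex.exp_conj, ← Complex.exp_add]
      congr 1
      simp
      ring
    rw [hB, h1]
    simp only [hw]
    field_simp
  set Θ : ℝ → ℝ := fun θ => α.arg + θ + (w θ).arg with hΘ
  have hpolar : ∀ θ : ℝ, planeMap A (Complex.exp (θ * Complex.I)) =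
        ‖planeMap A (Complex.exp (θ * Complex.I))‖ * Complex.exp (Θ θ * Complex.I) := by
    intro θ
    have h1 : ‖planeMap A (Complex.exp (θ * Complex.I))‖ = ‖α‖ * ‖w θ‖ := by
      rw [hfac, norm_mul, norm_mul, Complex.norm_exp_ofReal_mul_I, mul_one]
    have h2 : Complex.exp (Θ θ * Complex.I) =
        Complex.exp (α.arg * Complex.I) * Complex.exp (θ * Complex.I)
          * Complex.exp ((w θ).arg * Complex.I) := by
      rw [← Complex.exp_add, ← Complex.exp_add]
      congr 1
      simp only [hΘ]
      push_cast
      ring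
    rw [h1, h2, hfac]
    conv_lhs => rw [← Complex.norm_mul_exp_arg_mul_I α, ← Complex.norm_mul_exp_arg_mul_I (w θ)]
    push_cast
    ring
  have hcont : Continuous Θ := by
    refine (continuous_const.add continuous_id).add ?_
    rw [continuous_iff_continuousAt]
    intro θ
    exact ContinuousAt.comp (g := Complex.arg)
      (Complex.continuousAt_arg (Or.inl (hwre θ))) hwc.continuousAt
  have hper : ∀ (θ : ℝ) (j : ℤ), Θ (θ + j * (2 * Real.pi)) = Θ θ + j * (2 * Real.pi) := by
    intro θ j
    have h1 : w (θ + j * (2 * Real.pi)) = w θ := by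
      simp only [hw]
      congr 2
      rw [Complex.exp_eq_exp_iff_exists_int]
      refine ⟨-(2 * j), ?_⟩
      push_cast
      ring
    simp only [hΘ, h1]
    ring
  have hne : ∀ θ : ℝ, ‖planeMap A (Complex.exp (θ * Complex.I))‖ ≠ 0 := by
    intro θ
    rw [norm_ne_zero_iff]
    simp
  refine ⟨Θ, hcont, ⟨?_, ?_⟩, hper, hpolar⟩
  · intro θ θ' h
    have h1 := hpolar θ
    have h2 := hpolar θ'
    set a := ‖planeMap A (Complex.exp (θ * Complex.I))‖ with ha
    set b := ‖planeMap A (Complex.exp (θ' * Complex.I))‖ with hb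
    rw [← h] at h2
    have ha0 := hne θ
    have hb0 := hne θ'
    have h3 : planeMap A ((b : ℝ) • Complex.exp (θ * Complex.I)) =
        planeMap A ((a : ℝ) • Complex.exp (θ' * Complex.I)) := by
      rw [map_smul, map_smul, h1, h2, Complex.real_smul, Complex.real_smul]
      ring
    have h4 := (planeMap A).injective h3
    have h5 : b = a := by
      have h6 := congrArg norm h4
      rw [norm_smul, norm_smul, Complex.norm_exp_ofReal_mul_I, Complex.norm_exp_ofReal_mul_I,
        mul_one, mul_one, Real.norm_eq_abs, Real.norm_eq_abs, abs_of_nonneg, abs_of_nonneg] at h6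
      · exact h6
      · exact norm_nonneg _
      · exact norm_nonneg _
    rw [h5] at h4
    have h7 := smul_right_injective ℂ (show a ≠ 0 from ha0) h4
    obtain ⟨j, hj⟩ := Complex.exp_eq_exp_iff_exists_int.1 h7
    have h8 : θ = θ' + j * (2 * Real.pi) := by
      have h9 := congrArg Complex.im hj
      simpa using h9
    rw [h8, hper] at h
    rw [h8]
    linarith
  · have hb : ∀ θ, |(w θ).arg| ≤ Real.pi := fun θ => Complex.abs_arg_le_pi _
    refine hcont.surjective ?_ ?_
    · refine tendsto_atTop_mono (f := fun θ => θ + (α.arg - Real.pi)) ?_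
        (tendsto_atTop_add_const_right _ _ tendsto_id)
      intro θ
      simp only [hΘ]
      linarith [(abs_le.1 (hb θ)).1]
    · refine tendsto_atBot_mono (f := fun θ => θ + (α.arg + Real.pi)) ?_
        (tendsto_atBot_add_const_right _ _ tendsto_id)
      intro θ
      simp only [hΘ]
      linarith [(abs_le.1 (hb θ)).2]

/-- Post-composing the charts with a linear map keeps cone neighbourhoods. -/
theorem IsPolarChart.linearImage {X : Type*} [TopologicalSpace X] {sing : Set X}
    {atlas : Set (OpenPartialHomeomorph X ℂ)} {x : X} {k : ℕ} {ε : ℝ} {P : ℝ × ℝ → X}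
    (h : IsPolarChart sing atlas x k ε P) (A : Matrix.SpecialLinearGroup (Fin 2) ℝ) :
    ∃ (ε' : ℝ) (P' : ℝ × ℝ → X), IsPolarChart sing
      ((fun φ => φ.transHomeomorph (planeMap A).toHomeomorph) '' atlas) x k ε' P' := by
  obtain ⟨Θ, hΘc, hΘb, hΘp, hΘ⟩ := exists_angle_lift A⁻¹
  set ρ : ℝ → ℝ := fun θ => ‖planeMap A⁻¹ (Complex.exp (θ * Complex.I))‖ with hρ
  have hρc : Continuous ρ := by fun_prop
  have hρ0 : ∀ θ, 0 < ρ θ := fun θ => by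
    simp only [hρ]
    rw [norm_pos_iff]
    simp
  obtain ⟨M, hM0, hM⟩ : ∃ M : ℝ, 0 < M ∧ ∀ θ, ρ θ ≤ M := by
    refine ⟨‖(planeMap A⁻¹ : ℂ →L[ℝ] ℂ)‖ + 1, by positivity, fun θ => ?_⟩
    have h1 := (planeMap A⁻¹ : ℂ →L[ℝ] ℂ).le_opNorm (Complex.exp (θ * Complex.I))
    rw [Complex.norm_exp_ofReal_mul_I, mul_one] at h1
    exact h1.trans (by linarith)
  obtain ⟨C, hC0, hC⟩ : ∃ C : ℝ, 0 < C ∧ ∀ θ, 1 ≤ C * ρ θ := by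
    refine ⟨‖(planeMap A : ℂ →L[ℝ] ℂ)‖ + 1, by positivity, fun θ => ?_⟩
    have h1 := (planeMap A : ℂ →L[ℝ] ℂ).le_opNorm
      (planeMap A⁻¹ (Complex.exp (θ * Complex.I)))
    have h2 : (planeMap A : ℂ →L[ℝ] ℂ) (planeMap A⁻¹ (Complex.exp (θ * Complex.I))) =
      Complex.exp (θ * Complex.I) := planeMap_inv_apply A _
    rw [h2, Complex.norm_exp_ofReal_mul_I] at h1
    have h3 := hρ0 θ
    simp only [hρ] at h3 ⊢
    nlinarith
  have hMC : 1 ≤ C * M := (hC 0).trans (by gcongr; exact hM 0)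
  set G : ℝ × ℝ → ℝ × ℝ := fun q => (q.1 * ρ q.2, Θ q.2) with hG
  have hGc : Continuous G := by fun_prop
  have hε := h.pos
  have hlt : ∀ r θ, 0 ≤ r → r < ε / M → r * ρ θ < ε := fun r θ h0 h1 => by
    rw [lt_div_iff₀ hM0] at h1
    exact lt_of_le_of_lt (mul_le_mul_of_nonneg_left (hM θ) h0) h1
  have hmem : ∀ r θ, r ∈ Set.Ioo 0 (ε / M) → r * ρ θ ∈ Set.Ioo 0 ε := fun r θ hr =>
    ⟨mul_pos hr.1 (hρ0 θ), hlt r θ hr.1.le hr.2⟩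
  have hperiod : ∀ (θ : ℝ) (j : ℤ), Θ (θ + j * (2 * Real.pi * (k + 1))) =
      Θ θ + j * (2 * Real.pi * (k + 1)) := fun θ j => by
    have h1 := hΘp θ (j * (k + 1))
    push_cast at h1
    rw [show (j : ℝ) * (2 * Real.pi * (k + 1)) = j * (k + 1) * (2 * Real.pi) by ring]
    exact h1
  have hρper : ∀ (θ : ℝ) (j : ℤ), ρ (θ + j * (2 * Real.pi * (k + 1))) = ρ θ := fun θ j => by
    simp only [hρ]
    congr 2
    rw [Complex.exp_eq_exp_iff_exists_int]
    refine ⟨j * (k + 1), ?_⟩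
    push_cast
    ring
  refine ⟨ε / M, P ∘ G, ⟨by positivity, ?_, ?_, ?_, ?_, ?_, ?_⟩⟩
  · intro θ
    simp [hG, h.apex]
  · refine h.continuousOn.comp hGc.continuousOn ?_
    rintro ⟨r, θ⟩ ⟨hr, -⟩
    exact ⟨⟨mul_nonneg hr.1 (hρ0 θ).le, hlt r θ hr.1 hr.2⟩, trivial⟩
  · intro r hr r' hr' θ θ'
    simp only [Function.comp, hG]
    rw [h.eq_iff _ (hmem r θ hr) _ (hmem r' θ' hr')]
    constructor
    · rintro ⟨h1, j, hj⟩
      rw [← hperiod] at hj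
      have h2 := hΘb.1 hj
      refine ⟨?_, j, h2⟩
      rw [h2, hρper] at h1
      exact mul_right_cancel₀ (hρ0 θ).ne' h1
    · rintro ⟨rfl, j, rfl⟩
      exact ⟨by rw [hρper], j, hperiod θ j⟩
  · intro δ hδ
    have h1 : δ / C ∈ Set.Ioc 0 ε := by
      refine ⟨div_pos hδ.1 hC0, ?_⟩
      rw [div_le_iff₀ hC0]
      refine hδ.2.trans ?_
      rw [div_le_iff₀ hM0]
      nlinarith
    refine mem_of_superset (h.nhds _ h1) ?_
    rintro _ ⟨⟨s, ψ⟩, ⟨hs, -⟩, rfl⟩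
    obtain ⟨θ, rfl⟩ := hΘb.2 ψ
    refine ⟨(s / ρ θ, θ), ⟨⟨div_nonneg hs.1 (hρ0 θ).le, ?_⟩, trivial⟩, ?_⟩
    · rw [div_lt_iff₀ (hρ0 θ)]
      have h2 := hs.2
      rw [lt_div_iff₀ hC0] at h2
      have h3 : s ≤ s * (C * ρ θ) := le_mul_of_one_le_right hs.1 (hC θ)
      have h4 := mul_lt_mul_of_pos_right h2 (hρ0 θ)
      linarith
    · simp only [Function.comp, hG]
      rw [div_mul_cancel₀ _ (hρ0 θ).ne']
  · intro r hr θ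
    exact h.regular _ (hmem r θ hr) _
  · rintro r hr θ _ ⟨φ, hφ, rfl⟩ hs
    have h1 := h.translation _ (hmem r θ hr) (Θ θ) φ hφ hs
    have h2 : Tendsto G (𝓝 (r, θ)) (𝓝 (r * ρ θ, Θ θ)) := hGc.tendsto (r, θ)
    have hkey : ∀ (s ψ : ℝ), planeMap A (((s * ρ ψ : ℝ) : ℂ) * Complex.exp (Θ ψ * Complex.I)) =
        s * Complex.exp (ψ * Complex.I) := fun s ψ => by
      have h3 : ((s * ρ ψ : ℝ) : ℂ) * Complex.exp (Θ ψ * Complex.I) =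
          s • planeMap A⁻¹ (Complex.exp (ψ * Complex.I)) := by
        rw [hΘ ψ, Complex.real_smul]
        push_cast
        ring
      rw [h3, map_smul, planeMap_inv_apply, Complex.real_smul]
    filter_upwards [h2.eventually h1] with q hq
    have h4 := congrArg (planeMap A) hq
    rw [map_sub, map_sub, hkey] at h4
    simp only [hG] at h4
    rw [hkey] at h4
    exact h4

namespace TranslationSurface

variable {X : Type*} [TopologicalSpace X]

/-- The surface `A S`: same space and singular points, charts post-composed with `A`. -/
noncomputable def linearImage (A : Matrix.SpecialLinearGroup (Fin 2) ℝ)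
    (S : TranslationSurface X) : TranslationSurface X where
  compact := S.compact
  hausdorff := S.hausdorff
  connected := S.connected
  sing := S.sing
  finite_sing := S.finite_sing
  atlas := (fun φ => φ.transHomeomorph (planeMap A).toHomeomorph) '' S.atlas
  source_subset := by
    rintro _ ⟨φ, hφ, rfl⟩
    exact S.source_subset φ hφ
  cover := fun x hx => by
    obtain ⟨φ, hφ, h⟩ := S.cover x hx
    exact ⟨_, ⟨φ, hφ, rfl⟩, h⟩
  transition := by
    rintro _ ⟨φ, hφ, rfl⟩ _ ⟨ψ, hψ, rfl⟩ x hx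
    filter_upwards [S.transition φ hφ ψ hψ x hx] with y hy
    have h := congrArg (planeMap A) hy
    rw [map_sub, map_sub] at h
    exact h
  cone := fun x hx => by
    obtain ⟨k, ε, P, h⟩ := S.cone x hx
    obtain ⟨ε', P', h'⟩ := h.linearImage A
    exact ⟨k, ε', P', h'⟩

/-- The singular point `x` has cone angle `2π(k+1)`. -/
def HasConeAngle (S : TranslationSurface X) (x : X) (k : ℕ) : Prop :=
  ∃ (ε : ℝ) (P : ℝ × ℝ → X), IsPolarChart S.sing S.atlas x k ε P

/-- `S` belongs to the stratum of surfaces with exactly `n` singular points, all of cone angle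
`2π(k+1)`, where `n, k ≥ 1`. -/
def InStratum (S : TranslationSurface X) (k n : ℕ) : Prop :=
  1 ≤ k ∧ 1 ≤ n ∧ S.sing.ncard = n ∧ ∀ x ∈ S.sing, S.HasConeAngle x k

/-- A tiling of `S` by finitely many equal squares with sides parallel to the axes, glued by
translations, right sides to left sides and top sides to bottom sides, such that the singular
points of `S` are precisely the vertices of the squares. -/
structure SquareTiling (S : TranslationSurface X) where
  /-- the number of squares -/
  count : ℕ
  /-- the side length of the squares -/
  side : ℝ
  side_pos : 0 < side
  /-- the squares, parametrized by the closed square `[0, side] × [0, side]` -/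
  tile : Fin count → ℂ → X
  continuousOn : ∀ i, ContinuousOn (tile i) (Set.Icc 0 side ×ℂ Set.Icc 0 side)
  cover : ∀ x, ∃ i, ∃ z ∈ Set.Icc 0 side ×ℂ Set.Icc 0 side, tile i z = x
  -- the interior of a square is embedded, and meets no other square
  injective : ∀ i j, ∀ z ∈ Set.Ioo 0 side ×ℂ Set.Ioo 0 side,
    ∀ w ∈ Set.Icc 0 side ×ℂ Set.Icc 0 side, tile i z = tile j w → i = j ∧ z = w
  vertex_iff : ∀ i, ∀ z ∈ Set.Icc 0 side ×ℂ Set.Icc 0 side,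
    tile i z ∈ S.sing ↔ (z.re = 0 ∨ z.re = side) ∧ (z.im = 0 ∨ z.im = side)
  translation : ∀ i, ∀ z ∈ Set.Icc 0 side ×ℂ Set.Icc 0 side, ∀ φ ∈ S.atlas,
    tile i z ∈ φ.source → ∀ᶠ w in 𝓝[Set.Icc 0 side ×ℂ Set.Icc 0 side] z,
      φ (tile i w) - φ (tile i z) = w - z
  /-- the square glued to the right side of a given square -/
  right : Equiv.Perm (Fin count)
  /-- the square glued to the top side of a given square -/
  up : Equiv.Perm (Fin count)
  glue_right : ∀ i, ∀ t ∈ Set.Icc 0 side, tile i ⟨side, t⟩ = tile (right i) ⟨0, t⟩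
  glue_up : ∀ i, ∀ t ∈ Set.Icc 0 side, tile i ⟨t, side⟩ = tile (up i) ⟨t, 0⟩

/-- The area of a surface tiled by squares. -/
def SquareTiling.area {S : TranslationSurface X} (T : S.SquareTiling) : ℝ :=
  T.count * T.side ^ 2

/-- An oriented saddle connection: a straight segment, parametrized on `[0, 1]` with constant
velocity `hol` (its holonomy vector), which joins two singular points and has no singular point
in its interior. -/
@[ext]
structure SaddleConnection (S : TranslationSurface X) where
  path : C(unitInterval, X)
  hol : ℂ
  hol_ne_zero : hol ≠ 0
  initial_mem : path 0 ∈ S.sing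
  terminal_mem : path 1 ∈ S.sing
  interior : ∀ t : unitInterval, 0 < t → t < 1 → path t ∉ S.sing
  straight : ∀ t : unitInterval, 0 < t → t < 1 → ∀ φ ∈ S.atlas, path t ∈ φ.source →
    ∀ᶠ u in 𝓝 t, φ (path u) - φ (path t) = ((u : ℝ) - (t : ℝ) : ℝ) * hol

namespace SaddleConnection

variable {S : TranslationSurface X}

/-- The initial singular point. -/
def initial (s : S.SaddleConnection) : X := s.path 0

/-- The terminal singular point. -/
def terminal (s : S.SaddleConnection) : X := s.path 1

/-- The length of a saddle connection. -/
noncomputable def length (s : S.SaddleConnection) : ℝ := ‖s.hol‖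

/-- Near its initial point, `s` is the ray of angle `θ` in the polar coordinates `P`. -/
def LeavesAlong (s : S.SaddleConnection) (P : ℝ × ℝ → X) (θ : ℝ) : Prop :=
  ∀ᶠ u in 𝓝[>] (0 : unitInterval), s.path u = P ((u : ℝ) * ‖s.hol‖, θ)

/-- Near its terminal point, `s` is the ray of angle `θ` in the polar coordinates `P`. -/
def ArrivesAlong (s : S.SaddleConnection) (P : ℝ × ℝ → X) (θ : ℝ) : Prop :=
  ∀ᶠ u in 𝓝[<] (1 : unitInterval), s.path u = P ((1 - (u : ℝ)) * ‖s.hol‖, θ)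

/-- `t` starts where `s` ends, and the angle from `s` to `t`, moving clockwise around that
point, is `α`. -/
def HasClockwiseAngle (s t : S.SaddleConnection) (α : ℝ) : Prop :=
  s.terminal = t.initial ∧ ∃ (k : ℕ) (ε : ℝ) (P : ℝ × ℝ → X) (θ : ℝ),
    IsPolarChart S.sing S.atlas s.terminal k ε P ∧ s.ArrivesAlong P θ ∧
      t.LeavesAlong P (θ - α) ∧ 0 ≤ α ∧ α < 2 * Real.pi * (k + 1)

/-- `t` starts where `s` ends, and the angle from `s` to `t`, moving anticlockwise around that
point, is `α`. -/
def HasAnticlockwiseAngle (s t : S.SaddleConnection) (α : ℝ) : Prop :=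
  s.terminal = t.initial ∧ ∃ (k : ℕ) (ε : ℝ) (P : ℝ × ℝ → X) (θ : ℝ),
    IsPolarChart S.sing S.atlas s.terminal k ε P ∧ s.ArrivesAlong P θ ∧
      t.LeavesAlong P (θ + α) ∧ 0 ≤ α ∧ α < 2 * Real.pi * (k + 1)

/-- `s` followed by `t` is a geodesic: `t` starts where `s` ends, and the angles between them are
at least `π` on both sides. -/
def GeodesicTurn (s t : S.SaddleConnection) : Prop :=
  ∃ α β : ℝ, s.HasClockwiseAngle t α ∧ s.HasAnticlockwiseAngle t β ∧
    Real.pi ≤ α ∧ Real.pi ≤ β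

end SaddleConnection

variable {S : TranslationSurface X}

/-- Oriented saddle connection paths `s₁ … s_N`, `N ≥ 1`. -/
def IsSaddleConnectionPath (p : List S.SaddleConnection) : Prop :=
  p ≠ [] ∧ p.IsChain SaddleConnection.GeodesicTurn

/-- Singular connections: finite sequences of saddle connections in which all consecutive ones
form the clockwise angle `π`. -/
def IsSingularConnection (e : List S.SaddleConnection) : Prop :=
  e ≠ [] ∧ e.IsChain (fun s t => s.HasClockwiseAngle t Real.pi)

/-- `d = [e₁, …, e_m]` is a decomposition `p = e₁ … e_m` into singular connections, where no
`e_i e_{i+1}` is a singular connection. -/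
def IsMaximalDecomposition (p : List S.SaddleConnection)
    (d : List (List S.SaddleConnection)) : Prop :=
  d.flatten = p ∧ (∀ e ∈ d, IsSingularConnection e) ∧
    d.IsChain (fun e e' => ¬ IsSingularConnection (e ++ e'))

/-- The length of a path of saddle connections. -/
noncomputable def pathLength (p : List S.SaddleConnection) : ℝ :=
  (p.map SaddleConnection.length).sum

/-- The total holonomy vector of a sequence of saddle connections. -/
noncomputable def holonomy (p : List S.SaddleConnection) : ℂ :=
  (p.map SaddleConnection.hol).sum

/-- The oriented saddle connection paths on `S` that admit a unique decomposition into maximal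
singular connections, and for which this decomposition has `m` pieces. -/
def pathsWithPieces (S : TranslationSurface X) (m : ℕ) : Set (List S.SaddleConnection) :=
  {p | IsSaddleConnectionPath p ∧ ∃ d, IsMaximalDecomposition p d ∧
    (∀ d', IsMaximalDecomposition p d' → d' = d) ∧ d.length = m}

end TranslationSurface

/-- The image under `A` of the lattice `(1/√N) ℤ²` without the origin. -/
def latticeImage (A : Matrix.SpecialLinearGroup (Fin 2) ℝ) (N : ℕ) : Set ℂ :=
  {v | ∃ a b : ℤ, (a, b) ≠ (0, 0) ∧ v = planeMap A ⟨a / √(N : ℝ), b / √(N : ℝ)⟩}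

/-! A square-tiled surface whose singular points are exactly the vertices is a branched cover of a
square torus, branched only over the class of the vertices. Composing the charts with `A` merely
replaces the quotient map `q` of the plane by `q ∘ A⁻¹`, so the geometry is done for an abstract
`TorusCover`: a map that reads as `q` in the charts, up to translations, and vanishes exactly at the
singular points.

Since the surface is compact, the projection is a covering over the complement of `0`. Hence saddle
connections are the lifts of the segments from `0` to the primitive vectors of `ker q`, and each is
determined by its holonomy and its germ at the initial point. At a cone point of angle `2π(k+1)` a
direction has `k+1` lifts, so saddle connections correspond to triples of a singular point, a
residue in `ZMod (k+1)` and a primitive vector (`connection_bijective`).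

The clockwise angle `π` selects exactly one successor of a saddle connection, with the same holonomy
(`exists_next`). A singular connection is therefore a first saddle connection and a number of
repetitions, and its holonomy is a positive multiple of a primitive vector. Each nonzero vector of
`ker q` is such a multiple in exactly one way (`multiple_bijective`), so singular connections
correspond to triples of a singular point, a residue and a nonzero kernel vector.

Between two maximal singular connections the turn is geodesic but not the straight one. For each
primitive direction this rules out exactly one of the `k+1` residues (`exists_turn_iff`), which
accounts for `ZMod k`. Maximal decompositions are unique, so a path is a free first block followed
by `m - 1` such choices. Lengths add up because all saddle connections in a block have the same
holonomy.

To identify the lattice, the saddle connections whose holonomy is the diagonal of a square are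
counted twice: one for each square, and `k+1` for each singular point. This gives `n(k+1)` squares;
with area `1` the side is `1/√(n(k+1))`, so the nonzero kernel vectors are `A(Λ)`. -/

/-- A branched cover `proj` of a topological group `G`, locally modelled on a homomorphism
`q : ℂ → G`, which is a translation in the charts and is branched only over `0`. -/
structure TorusCover {X : Type*} [TopologicalSpace X] (S : TranslationSurface X)
    (G : Type*) [AddCommGroup G] [TopologicalSpace G] where
  q : ℂ →+ G
  isLocalHomeomorph_q : IsLocalHomeomorph q
  proj : X → G
  continuous_proj : Continuous proj
  proj_eq_zero_iff : ∀ x, proj x = 0 ↔ x ∈ S.sing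
  proj_sub : ∀ φ ∈ S.atlas, ∀ x ∈ φ.source, ∀ᶠ y in 𝓝 x, proj y - proj x = q (φ y - φ x)

theorem eq_of_eventually_eq {G : Type*} {a b : ℝ} {f : ℝ → G}
    (h : ∀ t ∈ Set.Ioo a b, ∀ᶠ u in 𝓝 t, f u = f t) {s t : ℝ} (hs : s ∈ Set.Ioo a b)
    (ht : t ∈ Set.Ioo a b) : f s = f t := by
  have : PreconnectedSpace (Set.Ioo a b) := isPreconnected_iff_preconnectedSpace.1 isPreconnected_Ioo
  have hl : IsLocallyConstant (fun u : Set.Ioo a b => f u) := by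
    rw [IsLocallyConstant.iff_eventually_eq]
    intro u
    exact (continuous_subtype_val.tendsto u).eventually (h u u.2)
  exact hl.apply_eq_of_preconnectedSpace ⟨s, hs⟩ ⟨t, ht⟩

/-- The point of the plane with polar coordinates `(r, θ)`. -/
noncomputable def planePolar (r θ : ℝ) : ℂ := r * Complex.exp (θ * Complex.I)

theorem norm_planePolar (r θ : ℝ) (hr : 0 ≤ r) : ‖planePolar r θ‖ = r := by
  simp [planePolar, Complex.norm_exp_ofReal_mul_I, abs_of_nonneg hr]

theorem planePolar_eq_smul (r θ : ℝ) : planePolar r θ = r • planePolar 1 θ := by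
  simp [planePolar]

/-! ### Lifting through the projection, away from the singular points. -/

namespace TorusCover

variable {X : Type*} [TopologicalSpace X] {S : TranslationSurface X}
  {G : Type*} [AddCommGroup G] [TopologicalSpace G] (C : TorusCover S G)

theorem continuous_q : Continuous C.q := C.isLocalHomeomorph_q.continuous

theorem exists_injOn_ball : ∃ ρ > 0, Set.InjOn C.q (Metric.ball 0 ρ) := by
  obtain ⟨e, he, heq⟩ := C.isLocalHomeomorph_q 0
  obtain ⟨ρ, hρ, hs⟩ := Metric.isOpen_iff.1 e.open_source 0 he
  refine ⟨ρ, hρ, fun a ha b hb hab => e.injOn (hs ha) (hs hb) ?_⟩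
  rw [← heq]
  exact hab

/-- A positive radius around the origin on which `q` is injective. -/
noncomputable def radius : ℝ := C.exists_injOn_ball.choose

theorem radius_pos : 0 < C.radius := C.exists_injOn_ball.choose_spec.1

theorem eq_of_q_eq {a b : ℂ} (ha : ‖a‖ < C.radius) (hb : ‖b‖ < C.radius) (h : C.q a = C.q b) :
    a = b :=
  C.exists_injOn_ball.choose_spec.2 (mem_ball_zero_iff.2 ha) (mem_ball_zero_iff.2 hb) h

theorem exists_nhds_injOn {x : X} (hx : x ∉ S.sing) : ∃ U ∈ 𝓝 x, Set.InjOn C.proj U := by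
  obtain ⟨φ, hφ, hxs⟩ := S.cover x hx
  have h1 : ∀ᶠ y in 𝓝 x, ‖φ y - φ x‖ < C.radius := by
    have hc : ContinuousAt (fun y => ‖φ y - φ x‖) x :=
      ((φ.continuousAt hxs).sub continuousAt_const).norm
    exact hc.eventually_lt continuousAt_const (by simpa using C.radius_pos)
  refine ⟨_, (C.proj_sub φ hφ x hxs).and (h1.and (φ.open_source.mem_nhds hxs)), ?_⟩
  rintro y ⟨hy1, hy2, hy3⟩ z ⟨hz1, hz2, hz3⟩ hyz
  have := C.eq_of_q_eq hy2 hz2 (by rw [← hy1, ← hz1, hyz])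
  exact φ.injOn hy3 hz3 (sub_left_injective this)

theorem isLocalHomeomorphOn_proj [IsTopologicalAddGroup G] :
    IsLocalHomeomorphOn C.proj (C.proj ⁻¹' {0}ᶜ) := by
  refine IsLocalHomeomorphOn.mk _ _ fun x hx => ?_
  have hx : x ∉ S.sing := fun h => hx ((C.proj_eq_zero_iff x).2 h)
  obtain ⟨φ, hφ, hxs⟩ := S.cover x hx
  obtain ⟨e, he, heq⟩ := C.isLocalHomeomorph_q 0
  obtain ⟨U, hU, hUo, hxU⟩ := eventually_nhds_iff.1 (C.proj_sub φ hφ x hxs)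
  let E := (((φ.restrOpen U hUo).transHomeomorph (Homeomorph.addRight (-φ x))).trans e).transHomeomorph
    (Homeomorph.addRight (C.proj x))
  have hE : ∀ y, E y = C.q (φ y - φ x) + C.proj x := fun y => by
    change e (φ y + -φ x) + C.proj x = _
    rw [← heq, sub_eq_add_neg]
  refine ⟨E, ?_, ?_⟩
  · simp [E, hxU, hxs, he]
  · intro y hy
    have hyU : y ∈ U := by
      simp [E] at hy
      exact hy.1.2
    rw [hE, ← hU y hyU, sub_add_cancel]

/-- Compactness of the surface turns the local homeomorphism into a covering, so that paths avoiding
`0` can be lifted. -/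
theorem isCoveringMapOn_proj [IsTopologicalAddGroup G] [T2Space G] :
    IsCoveringMapOn C.proj {0}ᶜ :=
  have := S.compact
  have := S.hausdorff
  .of_isLocalHomeomorphOn C.continuous_proj C.isLocalHomeomorphOn_proj

/-- Uniqueness of lifts away from the singular points. -/
theorem eqOn_of_lifts {Y : Type*} [TopologicalSpace Y] {s : Set Y} (hs : IsPreconnected s)
    {f g : Y → X} (hf : ContinuousOn f s) (hg : ContinuousOn g s) (hfs : ∀ y ∈ s, f y ∉ S.sing)
    (hgs : ∀ y ∈ s, g y ∉ S.sing) (h : ∀ y ∈ s, C.proj (f y) = C.proj (g y)) {a : Y} (ha : a ∈ s)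
    (hfg : f a = g a) : Set.EqOn f g s := by
  have := S.hausdorff
  have := isPreconnected_iff_preconnectedSpace.1 hs
  let p : {x // x ∉ S.sing} → G := fun x => C.proj x
  have hp : IsLocallyInjective p := by
    rw [isLocallyInjective_iff_nhds]
    intro x
    obtain ⟨U, hU, hi⟩ := C.exists_nhds_injOn x.2
    exact ⟨_, continuous_subtype_val.continuousAt hU, fun a ha b hb hab =>
      Subtype.ext (hi ha hb hab)⟩
  have h1 := IsSeparatedMap.eq_of_comp_eq (T2Space.isSeparatedMap p) hp
    (g₁ := fun y : s => ⟨f y, hfs y y.2⟩) (g₂ := fun y : s => ⟨g y, hgs y y.2⟩)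
    (by exact (continuousOn_iff_continuous_domRestrict.1 hf).subtype_mk _)
    (by exact (continuousOn_iff_continuous_domRestrict.1 hg).subtype_mk _)
    (by ext y; exact h y y.2) ⟨a, ha⟩ (Subtype.ext hfg)
  intro y hy
  exact congrArg Subtype.val (congrFun h1 ⟨y, hy⟩)

/-- A straight ray from a singular point projects to a ray from `0`. -/
theorem proj_ray [IsTopologicalAddGroup G] [T2Space G] {γ : ℝ → X} {δ : ℝ} {v : ℂ}
    (hc : ContinuousOn γ (Set.Ico 0 δ))
    (h0 : γ 0 ∈ S.sing) (hns : ∀ t ∈ Set.Ioo 0 δ, γ t ∉ S.sing)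
    (hst : ∀ t ∈ Set.Ioo 0 δ, ∀ φ ∈ S.atlas, γ t ∈ φ.source →
      ∀ᶠ u in 𝓝 t, φ (γ u) - φ (γ t) = (u - t : ℝ) * v) :
    ∀ t ∈ Set.Ico 0 δ, C.proj (γ t) = C.q (t * v) := by
  have hp0 : C.proj (γ 0) = 0 := (C.proj_eq_zero_iff _).2 h0
  intro t ht
  rcases ht.1.eq_or_lt with rfl | ht0
  · simp [hp0]
  have ht' : t ∈ Set.Ioo 0 δ := ⟨ht0, ht.2⟩
  -- The deviation from the expected ray is locally constant on the open interval, hence constant;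
  -- by continuity its value is the one at `0`, which vanishes.
  set f : ℝ → G := fun u => C.proj (γ u) - C.q (u * v) with hf
  have hlc : ∀ u ∈ Set.Ioo 0 δ, ∀ᶠ w in 𝓝 u, f w = f u := by
    intro u hu
    obtain ⟨φ, hφ, hs⟩ := S.cover _ (hns u hu)
    have hcu : ContinuousAt γ u := hc.continuousAt (Ico_mem_nhds hu.1 hu.2)
    filter_upwards [hst u hu φ hφ hs, hcu.eventually (C.proj_sub φ hφ _ hs)] with w h1 h2
    rw [h1] at h2
    simp only [hf]
    rw [sub_eq_sub_iff_sub_eq_sub, h2, ← map_sub]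
    push_cast
    ring_nf
  have hcf : ContinuousWithinAt f (Set.Ioo 0 δ) 0 := by
    have h1 : ContinuousWithinAt (fun u => C.proj (γ u)) (Set.Ioo 0 δ) 0 :=
      C.continuous_proj.continuousAt.comp_continuousWithinAt
        ((hc 0 ⟨le_rfl, ht0.trans ht.2⟩).mono Set.Ioo_subset_Ico_self)
    have h2 : Continuous (fun u : ℝ => C.q (u * v)) := C.continuous_q.comp (by fun_prop)
    exact h1.sub h2.continuousWithinAt
  have hne : (𝓝[Set.Ioo 0 δ] (0 : ℝ)).NeBot := by
    rw [nhdsWithin_Ioo_eq_nhdsGT (ht0.trans ht.2)]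
    infer_instance
  have h3 : Tendsto f (𝓝[Set.Ioo 0 δ] (0 : ℝ)) (𝓝 (f t)) := by
    refine tendsto_const_nhds.congr' ?_
    filter_upwards [self_mem_nhdsWithin] with u hu
    exact eq_of_eventually_eq hlc ht' hu
  have h4 := tendsto_nhds_unique h3 hcf
  have h5 : f 0 = 0 := by simp [hf, hp0]
  rw [h5] at h4
  exact sub_eq_zero.1 h4

end TorusCover

/-! ### Polar coordinates under the projection. -/

namespace IsPolarChart

variable {X : Type*} [TopologicalSpace X] {sing : Set X} {atlas : Set (OpenPartialHomeomorph X ℂ)}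
  {x : X} {k : ℕ} {ε : ℝ} {P : ℝ × ℝ → X} (h : IsPolarChart sing atlas x k ε P)

include h

theorem continuousOn_ray (θ : ℝ) : ContinuousOn (fun r => P (r, θ)) (Set.Ico 0 ε) :=
  h.continuousOn.comp (by fun_prop) fun _ hr => ⟨hr, trivial⟩

theorem periodic {r : ℝ} (hr : r ∈ Set.Ioo 0 ε) (θ : ℝ) (j : ℤ) :
    P (r, θ + j * (2 * Real.pi * (k + 1))) = P (r, θ) :=
  ((h.eq_iff r hr r hr _ _).2 ⟨rfl, j, rfl⟩).symm

end IsPolarChart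

namespace TorusCover

variable {X : Type*} [TopologicalSpace X] {S : TranslationSurface X}
  {G : Type*} [AddCommGroup G] [TopologicalSpace G] (C : TorusCover S G)
  [IsTopologicalAddGroup G] [T2Space G]

theorem proj_polar {x : X} {k : ℕ} {ε : ℝ} {P : ℝ × ℝ → X} (hx : x ∈ S.sing)
    (h : IsPolarChart S.sing S.atlas x k ε P) {r : ℝ} (hr : r ∈ Set.Ico 0 ε) (θ : ℝ) :
    C.proj (P (r, θ)) = C.q (planePolar r θ) := by
  refine C.proj_ray (γ := fun r => P (r, θ)) (h.continuousOn_ray θ) ?_ (fun t ht => h.regular t ht θ)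
    ?_ r hr
  · simpa [h.apex] using hx
  · intro t ht φ hφ hs
    have hc : Tendsto (fun u : ℝ => (u, θ)) (𝓝 t) (𝓝 (t, θ)) :=
      Continuous.tendsto (by fun_prop) t
    filter_upwards [hc.eventually (h.translation t ht θ φ hφ hs)] with u hu
    rw [hu]
    push_cast
    ring

/-- A lift of a ray from `0`, which accumulates at the singular point `x`, is a ray in polar
coordinates around `x`. -/
theorem exists_eq_polar {x : X} {k : ℕ} {ε : ℝ} {P : ℝ × ℝ → X} (hx : x ∈ S.sing)
    (h : IsPolarChart S.sing S.atlas x k ε P) {γ : ℝ → X} {δ : ℝ} (hδ : 0 < δ) {v : ℂ}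
    (hv : v ≠ 0) (hc : ContinuousOn γ (Set.Ioo 0 δ)) (hns : ∀ t ∈ Set.Ioo 0 δ, γ t ∉ S.sing)
    (hp : ∀ t ∈ Set.Ioo 0 δ, C.proj (γ t) = C.q (t * v)) (hcl : MapClusterPt x (𝓝[>] 0) γ) :
    ∃ θ, planePolar ‖v‖ θ = v ∧ ∀ t ∈ Set.Ioo 0 (min δ (ε / ‖v‖)), γ t = P (t * ‖v‖, θ) := by
  have hv0 : 0 < ‖v‖ := norm_pos_iff.2 hv
  -- Below this radius both `t₀ * v` and the polar vector lie where `q` is injective, so equality of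
  -- their images is equality in the plane. One common point then suffices, by unique lifting; this
  -- is why a cluster point is enough.
  set ε' := min ε C.radius with hε'
  have hε0 : 0 < ε' := lt_min h.pos C.radius_pos
  have hf := mapClusterPt_iff_frequently.1 hcl _ (h.nhds ε' ⟨hε0, min_le_left _ _⟩)
  have he : ∀ᶠ t in 𝓝[>] (0 : ℝ), t ∈ Set.Ioo 0 (min δ (ε' / ‖v‖)) :=
    Ioo_mem_nhdsGT (lt_min hδ (div_pos hε0 hv0))
  obtain ⟨t₀, ⟨⟨r, θ⟩, ⟨hr, -⟩, hPt⟩, ht0, ht1⟩ := (hf.and_eventually he).exists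
  obtain ⟨ht1, ht2⟩ := lt_min_iff.1 ht1
  rw [lt_div_iff₀ hv0] at ht2
  obtain ⟨hr1, hr2⟩ := lt_min_iff.1 hr.2
  obtain ⟨ht3, ht4⟩ := lt_min_iff.1 ht2
  have hr : r ∈ Set.Ico 0 ε := ⟨hr.1, hr1⟩
  have h1 : C.q (t₀ * v) = C.q (planePolar r θ) := by
    rw [← C.proj_polar hx h hr, hPt, hp _ ⟨ht0, ht1⟩]
  have hn : ‖(t₀ : ℂ) * v‖ = t₀ * ‖v‖ := by
    rw [norm_mul, Complex.norm_real, Real.norm_of_nonneg ht0.le]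
  have h2 := C.eq_of_q_eq (by rwa [hn]) (by rwa [norm_planePolar _ _ hr.1]) h1
  have h3 : t₀ * ‖v‖ = r := by
    rw [← hn, h2, norm_planePolar _ _ hr.1]
  have h4 : planePolar ‖v‖ θ = v := by
    rw [← h3, planePolar_eq_smul, mul_smul, ← planePolar_eq_smul, Complex.real_smul] at h2
    exact (mul_left_cancel₀ (by exact_mod_cast ht0.ne') h2).symm
  refine ⟨θ, h4, ?_⟩
  have hmem : ∀ t ∈ Set.Ioo 0 (min δ (ε / ‖v‖)), t * ‖v‖ ∈ Set.Ioo 0 ε := fun t ht =>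
    ⟨mul_pos ht.1 hv0, (lt_div_iff₀ hv0).1 (lt_min_iff.1 ht.2).2⟩
  have hsub : Set.Ioo 0 (min δ (ε / ‖v‖)) ⊆ Set.Ioo 0 δ :=
    Set.Ioo_subset_Ioo_right (min_le_left _ _)
  refine C.eqOn_of_lifts (g := fun t => P (t * ‖v‖, θ)) isPreconnected_Ioo (hc.mono hsub) ?_
    (fun t ht => hns t (hsub ht)) (fun t ht => h.regular _ (hmem t ht) θ) ?_ (a := t₀) ?_ ?_
  · exact (h.continuousOn_ray θ).comp (by fun_prop) fun t ht =>
      Set.Ioo_subset_Ico_self (hmem t ht)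
  · intro t ht
    rw [hp t (hsub ht), C.proj_polar hx h (Set.Ioo_subset_Ico_self (hmem t ht)),
      planePolar_eq_smul, mul_smul, ← planePolar_eq_smul, h4, Complex.real_smul]
  · exact ⟨ht0, lt_min ht1 ((lt_div_iff₀ hv0).2 ht3)⟩
  · rw [← hPt, h3]

/-- Two polar charts at a singular point differ by a rotation. -/
theorem exists_polar_rotation (C : TorusCover S G) {x : X} {k k' : ℕ} {ε ε' : ℝ} {P P' : ℝ × ℝ → X} (hx : x ∈ S.sing)
    (h : IsPolarChart S.sing S.atlas x k ε P) (h' : IsPolarChart S.sing S.atlas x k' ε' P') :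
    k' = k ∧ ∃ c, ∀ r ∈ Set.Ioo 0 (min ε ε'), ∀ θ, P' (r, θ) = P (r, θ + c) := by
  have hm : 0 < min ε ε' := lt_min h.pos h'.pos
  have hcl : MapClusterPt x (𝓝[>] 0) (fun r => P' (r, 0)) := by
    have h1 : Tendsto (fun r => P' (r, 0)) (𝓝[>] 0) (𝓝 x) := by
      have h2 := (h'.continuousOn_ray 0) 0 ⟨le_rfl, h'.pos⟩
      have h3 := h2.mono Set.Ioo_subset_Ico_self
      rw [ContinuousWithinAt, nhdsWithin_Ioo_eq_nhdsGT h'.pos] at h3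
      rwa [h'.apex] at h3
    exact h1.mapClusterPt
  -- The ray of angle `0` in `P'` is the ray of some angle `c` in `P`, and `c` is a multiple of
  -- `2π`. So `P'` and `P` rotated by `c` lift the same map on a connected strip and agree at one
  -- point.
  obtain ⟨c, hc1, hc2⟩ := C.exists_eq_polar hx h h'.pos (v := 1) one_ne_zero
    ((h'.continuousOn_ray 0).mono Set.Ioo_subset_Ico_self) (fun t ht => h'.regular t ht 0)
    (fun t ht => by
      rw [C.proj_polar hx h' (Set.Ioo_subset_Ico_self ht)]
      simp [planePolar]) hcl
  simp only [norm_one, div_one, mul_one, min_comm ε' ε] at hc1 hc2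
  have hl : ∀ r ∈ Set.Ioo 0 (min ε ε'), r ∈ Set.Ioo 0 ε := fun r hr =>
    ⟨hr.1, (lt_min_iff.1 hr.2).1⟩
  have hr : ∀ r ∈ Set.Ioo 0 (min ε ε'), r ∈ Set.Ioo 0 ε' := fun r hr =>
    ⟨hr.1, (lt_min_iff.1 hr.2).2⟩
  have hmid : min ε ε' / 2 ∈ Set.Ioo 0 (min ε ε') := ⟨by positivity, by linarith⟩
  have key : ∀ r ∈ Set.Ioo 0 (min ε ε'), ∀ θ, P' (r, θ) = P (r, θ + c) := by
    have h1 := C.eqOn_of_lifts (s := Set.Ioo 0 (min ε ε') ×ˢ (Set.univ : Set ℝ))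
      (f := P') (g := fun p => P (p.1, p.2 + c))
      (isPreconnected_Ioo.prod isPreconnected_univ)
      (h'.continuousOn.mono (Set.prod_mono_left fun r hr' => Set.Ioo_subset_Ico_self (hr r hr')))
      (h.continuousOn.comp (by fun_prop) fun p hp =>
        ⟨Set.Ioo_subset_Ico_self (hl _ hp.1), trivial⟩)
      (fun p hp => h'.regular _ (hr _ hp.1) _) (fun p hp => h.regular _ (hl _ hp.1) _)
      (fun p hp => by
        rw [C.proj_polar hx h (Set.Ioo_subset_Ico_self (hl _ hp.1)),
          C.proj_polar hx h' (Set.Ioo_subset_Ico_self (hr _ hp.1))]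
        congr 1
        simp only [planePolar] at hc1 ⊢
        push_cast
        rw [add_mul, Complex.exp_add]
        push_cast at hc1
        rw [one_mul] at hc1
        rw [hc1, mul_one])
      (a := (min ε ε' / 2, 0)) ⟨hmid, trivial⟩ (by simpa using hc2 _ hmid)
    exact fun r hr θ => h1 (x := (r, θ)) ⟨hr, trivial⟩
  refine ⟨?_, c, key⟩
  have hpi := Real.pi_pos
  -- The angular period of each chart is an integer multiple of that of the other, so `k + 1` and
  -- `k' + 1` divide one another.
  obtain ⟨-, j, hj⟩ := (h.eq_iff _ (hl _ hmid) _ (hl _ hmid) c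
    (1 * (2 * Real.pi * (k' + 1)) + c)).1 (by
      have h1 := key _ hmid 0
      have h2 := key _ hmid (0 + (1 : ℤ) * (2 * Real.pi * (k' + 1)))
      rw [h'.periodic (hr _ hmid), h1] at h2
      simpa using h2)
  obtain ⟨-, j', hj'⟩ := (h'.eq_iff _ (hr _ hmid) _ (hr _ hmid) (-c)
    (-c + 1 * (2 * Real.pi * (k + 1)))).1 (by
      rw [key _ hmid, key _ hmid]
      have h1 := h.periodic (hl _ hmid) 0 1
      simp only [neg_add_cancel]
      rw [← h1]
      congr 2
      push_cast
      ring)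
  have h1 : ((k' + 1 : ℤ) : ℝ) = j * (k + 1 : ℤ) := by
    have : 2 * Real.pi * ((k' + 1 : ℝ) - j * (k + 1)) = 0 := by linarith
    push_cast
    rcases mul_eq_zero.1 this with h | h <;> linarith
  have h2 : ((k + 1 : ℤ) : ℝ) = j' * (k' + 1 : ℤ) := by
    have : 2 * Real.pi * ((k + 1 : ℝ) - j' * (k' + 1)) = 0 := by linarith
    push_cast
    rcases mul_eq_zero.1 this with h | h <;> linarith
  norm_cast at h1 h2
  have h3 : (k + 1 : ℤ) ∣ (k' + 1 : ℤ) := ⟨j, by push_cast at h1 ⊢; rw [h1]; ring⟩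
  have h4 : (k' + 1 : ℤ) ∣ (k + 1 : ℤ) := ⟨j', by push_cast at h2 ⊢; rw [h2]; ring⟩
  have h5 := Int.le_of_dvd (by positivity) h3
  have h6 := Int.le_of_dvd (by positivity) h4
  omega

end TorusCover

/-! ### Primitive vectors of the kernel. -/

namespace TorusCover

variable {X : Type*} [TopologicalSpace X] {S : TranslationSurface X}
  {G : Type*} [AddCommGroup G] [TopologicalSpace G] (C : TorusCover S G)

/-- A primitive vector of the lattice `ker q`. -/
def IsPrimitive (v : ℂ) : Prop := C.q v = 0 ∧ ∀ t ∈ Set.Ioo (0 : ℝ) 1, C.q (t * v) ≠ 0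

variable {C}

theorem IsPrimitive.ne_zero {v : ℂ} (h : C.IsPrimitive v) : v ≠ 0 := by
  rintro rfl
  exact h.2 (1 / 2) (by norm_num) (by simp)

/-- On a common ray, the shorter vector would be a kernel point in the interior of the longer
segment. -/
theorem IsPrimitive.eq_of_planePolar {v w : ℂ} (hv : C.IsPrimitive v) (hw : C.IsPrimitive w)
    {θ : ℝ} (h : planePolar ‖v‖ θ = v) (h' : planePolar ‖w‖ θ = w) : v = w := by
  have key : ∀ v w : ℂ, C.IsPrimitive v → C.IsPrimitive w → planePolar ‖v‖ θ = v →
      planePolar ‖w‖ θ = w → ‖w‖ ≤ ‖v‖ := by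
    intro v w hv hw h h'
    by_contra! hlt
    have hv0 : 0 < ‖v‖ := norm_pos_iff.2 hv.ne_zero
    have hw0 : 0 < ‖w‖ := norm_pos_iff.2 hw.ne_zero
    refine hw.2 (‖v‖ / ‖w‖) ⟨by positivity, (div_lt_one hw0).2 hlt⟩ ?_
    rw [← Complex.real_smul]
    nth_rw 2 [← h']
    rw [planePolar_eq_smul, smul_smul, div_mul_cancel₀ _ hw0.ne', ← planePolar_eq_smul, h, hv.1]
  rw [← h, ← h', le_antisymm (key w v hw hv h' h) (key v w hv hw h h')]

end TorusCover

/-! ### Saddle connections as lifts of primitive segments. -/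

namespace TranslationSurface.SaddleConnection

variable {X : Type*} [TopologicalSpace X] {S : TranslationSurface X}

/-- A saddle connection with the opposite orientation. -/
def reverse (s : S.SaddleConnection) : S.SaddleConnection where
  path := s.path.comp ⟨unitInterval.symm, unitInterval.continuous_symm⟩
  hol := -s.hol
  hol_ne_zero := neg_ne_zero.2 s.hol_ne_zero
  initial_mem := by simpa using s.terminal_mem
  terminal_mem := by simpa using s.initial_mem
  interior := fun t h0 h1 => s.interior (unitInterval.symm t)
    (by rw [← unitInterval.symm_one]; exact unitInterval.strictAnti_symm h1)
    (by rw [← unitInterval.symm_zero]; exact unitInterval.strictAnti_symm h0)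
  straight := fun t h0 h1 φ hφ ht => by
    have h := s.straight (unitInterval.symm t)
      (by rw [← unitInterval.symm_one]; exact unitInterval.strictAnti_symm h1)
      (by rw [← unitInterval.symm_zero]; exact unitInterval.strictAnti_symm h0) φ hφ ht
    filter_upwards [unitInterval.continuous_symm.continuousAt.eventually h] with u hu
    simp only [ContinuousMap.comp_apply, ContinuousMap.coe_mk]
    rw [hu]
    simp
    ring

/-- A saddle connection, parametrized by the line. -/
noncomputable def ray (s : S.SaddleConnection) (t : ℝ) : X :=
  s.path (Set.projIcc 0 1 zero_le_one t)

variable (s : S.SaddleConnection)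

theorem continuous_ray : Continuous s.ray := s.path.continuous.comp continuous_projIcc

theorem ray_coe (u : unitInterval) : s.ray u = s.path u := by
  simp [ray]

theorem ray_zero : s.ray 0 = s.initial := s.ray_coe 0

theorem ray_notMem {t : ℝ} (ht : t ∈ Set.Ioo (0 : ℝ) 1) : s.ray t ∉ S.sing := by
  have h := s.ray_coe ⟨t, ht.1.le, ht.2.le⟩
  rw [show s.ray t = _ from h]
  exact s.interior _ ht.1 ht.2

theorem ray_straight {t : ℝ} (ht : t ∈ Set.Ioo (0 : ℝ) 1) (φ : OpenPartialHomeomorph X ℂ)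
    (hφ : φ ∈ S.atlas) (h : s.ray t ∈ φ.source) :
    ∀ᶠ u in 𝓝 t, φ (s.ray u) - φ (s.ray t) = (u - t : ℝ) * s.hol := by
  have hc : Tendsto (Set.projIcc (0 : ℝ) 1 zero_le_one) (𝓝 t)
      (𝓝 (Set.projIcc 0 1 zero_le_one t)) := continuous_projIcc.tendsto t
  have hpt : Set.projIcc (0 : ℝ) 1 zero_le_one t = ⟨t, ht.1.le, ht.2.le⟩ :=
    Set.projIcc_of_mem zero_le_one ⟨ht.1.le, ht.2.le⟩
  have h1 := s.straight (Set.projIcc 0 1 zero_le_one t) (by rw [hpt]; exact ht.1)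
    (by rw [hpt]; exact ht.2) φ hφ h
  filter_upwards [hc.eventually h1, Ioo_mem_nhds ht.1 ht.2] with u hu hu2
  have hpu : Set.projIcc (0 : ℝ) 1 zero_le_one u = ⟨u, hu2.1.le, hu2.2.le⟩ :=
    Set.projIcc_of_mem zero_le_one ⟨hu2.1.le, hu2.2.le⟩
  rw [hpt, hpu] at hu
  simp only [ray, hpt, hpu]
  exact hu

theorem eventually_nhdsGT_zero {p : ℝ → Prop} {δ : ℝ} (hδ : 0 < δ) (h : ∀ t ∈ Set.Ioo 0 δ, p t) :
    ∀ᶠ u : unitInterval in 𝓝[>] 0, p u := by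
  have h1 : Tendsto (fun u : unitInterval => (u : ℝ)) (𝓝[>] (0 : unitInterval)) (𝓝 0) :=
    (continuous_subtype_val.tendsto (0 : unitInterval)).mono_left nhdsWithin_le_nhds
  filter_upwards [h1.eventually (gt_mem_nhds hδ), self_mem_nhdsWithin] with u hu hu0
  exact h u ⟨hu0, hu⟩

instance : (𝓝[>] (0 : unitInterval)).NeBot :=
  nhdsGT_neBot_of_exists_gt ⟨1, zero_lt_one⟩

theorem symm_tendsto : Tendsto unitInterval.symm (𝓝[<] 1) (𝓝[>] 0) := by
  refine tendsto_nhdsWithin_iff.2 ⟨?_, ?_⟩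
  · have h := (unitInterval.continuous_symm.tendsto 1).mono_left
      (nhdsWithin_le_nhds (s := Set.Iio (1 : unitInterval)))
    rwa [unitInterval.symm_one] at h
  · filter_upwards [self_mem_nhdsWithin] with u hu
    have := unitInterval.strictAnti_symm hu
    rwa [unitInterval.symm_one] at this

theorem symm_tendsto' : Tendsto unitInterval.symm (𝓝[>] 0) (𝓝[<] 1) := by
  refine tendsto_nhdsWithin_iff.2 ⟨?_, ?_⟩
  · have h := (unitInterval.continuous_symm.tendsto 0).mono_left
      (nhdsWithin_le_nhds (s := Set.Ioi (0 : unitInterval)))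
    rwa [unitInterval.symm_zero] at h
  · filter_upwards [self_mem_nhdsWithin] with u hu
    have := unitInterval.strictAnti_symm hu
    rwa [unitInterval.symm_zero] at this

theorem arrivesAlong_iff {P : ℝ × ℝ → X} {θ : ℝ} :
    s.ArrivesAlong P θ ↔ s.reverse.LeavesAlong P θ := by
  constructor
  · intro h
    filter_upwards [symm_tendsto'.eventually h] with u hu
    simpa [reverse] using hu
  · intro h
    filter_upwards [symm_tendsto.eventually h] with u hu
    simpa [reverse] using hu

variable {s}

theorem LeavesAlong.comp {P P' : ℝ × ℝ → X} {θ θ' δ : ℝ} (h : s.LeavesAlong P θ) (hδ : 0 < δ)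
    (hP : ∀ r ∈ Set.Ioo 0 δ, P' (r, θ') = P (r, θ)) : s.LeavesAlong P' θ' := by
  have hv : 0 < ‖s.hol‖ := norm_pos_iff.2 s.hol_ne_zero
  filter_upwards [h, eventually_nhdsGT_zero (p := fun t => P' (t * ‖s.hol‖, θ') =
    P (t * ‖s.hol‖, θ)) (div_pos hδ hv) fun t ht =>
      hP _ ⟨mul_pos ht.1 hv, (lt_div_iff₀ hv).1 ht.2⟩] with u h1 h2
  rw [h1, h2]

theorem LeavesAlong.iff {x : X} {k : ℕ} {ε : ℝ} {P : ℝ × ℝ → X} {θ θ' : ℝ}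
    (h : s.LeavesAlong P θ) (hP : IsPolarChart S.sing S.atlas x k ε P) :
    s.LeavesAlong P θ' ↔ ∃ j : ℤ, θ' = θ + j * (2 * Real.pi * (k + 1)) := by
  have hv : 0 < ‖s.hol‖ := norm_pos_iff.2 s.hol_ne_zero
  constructor
  · intro h'
    obtain ⟨u, ⟨h1, h2⟩, h3, h4⟩ := ((h.and h').and (eventually_nhdsGT_zero
      (p := fun t => 0 < t * ‖s.hol‖ ∧ t * ‖s.hol‖ < ε) (div_pos hP.pos hv) fun t ht =>
      ⟨mul_pos ht.1 hv, (lt_div_iff₀ hv).1 ht.2⟩)).exists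
    exact ((hP.eq_iff _ ⟨h3, h4⟩ _ ⟨h3, h4⟩ _ _).1 (h1.symm.trans h2)).2
  · rintro ⟨j, rfl⟩
    exact h.comp hP.pos fun r hr => hP.periodic hr θ j

variable {G : Type*} [AddCommGroup G] [TopologicalSpace G] [IsTopologicalAddGroup G] [T2Space G]
  (C : TorusCover S G)

theorem proj_path (s : S.SaddleConnection) (u : unitInterval) :
    C.proj (s.path u) = C.q (u * s.hol) := by
  have h := C.proj_ray (γ := s.ray) (δ := 1) s.continuous_ray.continuousOn
    (by rw [ray_zero]; exact s.initial_mem) (fun t ht => s.ray_notMem ht)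
    (fun t ht φ hφ hs => s.ray_straight ht φ hφ hs)
  have hcl : IsClosed {t : ℝ | C.proj (s.ray t) = C.q (t * s.hol)} :=
    isClosed_eq (C.continuous_proj.comp s.continuous_ray) (C.continuous_q.comp (by fun_prop))
  have h2 : Set.Icc (0 : ℝ) 1 ⊆ {t : ℝ | C.proj (s.ray t) = C.q (t * s.hol)} := by
    rw [← closure_Ico (zero_ne_one' ℝ)]
    exact closure_minimal h hcl
  have h3 := h2 u.2
  rwa [Set.mem_ofPred_eq, ray_coe] at h3

/-- The endpoint lies over `0` and interior points do not, because the fibre of `0` is exactly the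
singular set. -/
theorem isPrimitive_hol (s : S.SaddleConnection) : C.IsPrimitive s.hol := by
  constructor
  · have h := s.proj_path C 1
    simp only [Set.Icc.coe_one, Complex.ofReal_one, one_mul] at h
    rw [← h, C.proj_eq_zero_iff]
    exact s.terminal_mem
  · intro t ht h0
    rw [← s.proj_path C ⟨t, ht.1.le, ht.2.le⟩, C.proj_eq_zero_iff] at h0
    exact s.interior _ ht.1 ht.2 h0

include C in
theorem exists_leavesAlong (s : S.SaddleConnection) {k : ℕ} {ε : ℝ} {P : ℝ × ℝ → X}
    (hP : IsPolarChart S.sing S.atlas s.initial k ε P) :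
    ∃ θ, planePolar ‖s.hol‖ θ = s.hol ∧ s.LeavesAlong P θ := by
  have hv : 0 < ‖s.hol‖ := norm_pos_iff.2 s.hol_ne_zero
  obtain ⟨θ, h1, h2⟩ := C.exists_eq_polar s.initial_mem hP (γ := s.ray) one_pos s.hol_ne_zero
    s.continuous_ray.continuousOn (fun t ht => s.ray_notMem ht)
    (fun t ht => by
      have := s.proj_path C ⟨t, ht.1.le, ht.2.le⟩
      rwa [← ray_coe] at this)
    (by
      have h : Tendsto s.ray (𝓝[>] 0) (𝓝 (s.ray 0)) :=
        (s.continuous_ray.tendsto 0).mono_left nhdsWithin_le_nhds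
      rw [ray_zero] at h
      exact h.mapClusterPt)
  refine ⟨θ, h1, ?_⟩
  filter_upwards [eventually_nhdsGT_zero (lt_min one_pos (div_pos hP.pos hv)) h2] with u hu
  rwa [ray_coe] at hu

include C in
-- Equal holonomies make both paths lifts of the same segment. Unique lifting applies on the open
-- interval, and continuity settles the endpoints.
theorem ext_of_path_eq {s s' : S.SaddleConnection} {u : unitInterval} (h0 : 0 < u) (h1 : u < 1)
    (h : s.path u = s'.path u) (hh : s.hol = s'.hol) : s = s' := by
  have := S.hausdorff
  refine SaddleConnection.ext ?_ hh
  have h4 := C.eqOn_of_lifts (f := s.ray) (g := s'.ray) (isPreconnected_Ioo (a := (0 : ℝ)) (b := 1))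
    s.continuous_ray.continuousOn s'.continuous_ray.continuousOn (fun t ht => s.ray_notMem ht)
    (fun t ht => s'.ray_notMem ht)
    (fun t ht => by
      have h5 := s.proj_path C ⟨t, ht.1.le, ht.2.le⟩
      have h6 := s'.proj_path C ⟨t, ht.1.le, ht.2.le⟩
      rw [← ray_coe] at h5 h6
      rw [h5, h6, hh]) (a := u) ⟨h0, h1⟩ (by rw [ray_coe, ray_coe, h])
  have h5 : Set.EqOn s.ray s'.ray (Set.Icc 0 1) := by
    rw [← closure_Ioo (zero_ne_one' ℝ)]
    exact h4.closure s.continuous_ray s'.continuous_ray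
  ext u
  rw [← ray_coe, ← ray_coe]
  exact h5 u.2

include C in
/-- A saddle connection is determined by its holonomy vector and its germ at the initial point. -/
theorem ext_of_leavesAlong {s s' : S.SaddleConnection} {P : ℝ × ℝ → X} {θ : ℝ}
    (hs : s.LeavesAlong P θ) (hs' : s'.LeavesAlong P θ) (hh : s.hol = s'.hol) : s = s' := by
  have hlt := eventually_nhdsGT_zero (p := fun t => t ∈ Set.Ioo (0 : ℝ) 1) one_pos fun t ht => ht
  obtain ⟨u, ⟨h1, h2⟩, h3⟩ := ((hs.and hs').and hlt).exists
  exact ext_of_path_eq C (u := u) h3.1 h3.2 (by rw [h1, h2, hh]) hh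

end TranslationSurface.SaddleConnection

/-! ### Existence of saddle connections with given germ and holonomy. -/

namespace TorusCover

variable {X : Type*} [TopologicalSpace X] {S : TranslationSurface X}
  {G : Type*} [AddCommGroup G] [TopologicalSpace G] [IsTopologicalAddGroup G] [T2Space G]

omit [IsTopologicalAddGroup G] [T2Space G] in
-- The chart displacement and the straight displacement are both small and have the same image under
-- `q`, which is injective near `0`. Thus lifts of segments are straight.
theorem eventually_straight (C : TorusCover S G) {γ : ℝ → X} {v : ℂ} {t : ℝ}
    (hc : ContinuousAt γ t) (hp : ∀ᶠ u in 𝓝 t, C.proj (γ u) = C.q (u * v))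
    (φ : OpenPartialHomeomorph X ℂ) (hφ : φ ∈ S.atlas) (ht : γ t ∈ φ.source) :
    ∀ᶠ u in 𝓝 t, φ (γ u) - φ (γ t) = (u - t : ℝ) * v := by
  have h1 : ∀ᶠ u in 𝓝 t, ‖φ (γ u) - φ (γ t)‖ < C.radius := by
    have : ContinuousAt (fun u => ‖φ (γ u) - φ (γ t)‖) t :=
      (((φ.continuousAt ht).comp hc).sub continuousAt_const).norm
    exact this.eventually_lt continuousAt_const (by simpa using C.radius_pos)
  have h2 : ∀ᶠ u in 𝓝 t, ‖((u - t : ℝ) : ℂ) * v‖ < C.radius := by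
    have : ContinuousAt (fun u : ℝ => ‖((u - t : ℝ) : ℂ) * v‖) t := by fun_prop
    exact this.eventually_lt continuousAt_const (by simpa using C.radius_pos)
  filter_upwards [h1, h2, hp, hc.eventually (C.proj_sub φ hφ _ ht)] with u h1 h2 h3 h4
  refine C.eq_of_q_eq h1 h2 ?_
  rw [← h4, h3, hp.self_of_nhds, ← map_sub]
  push_cast
  ring_nf

/-- A primitive segment from `0` lifts to a ray starting along a given direction. -/
theorem exists_lift (C : TorusCover S G) {x : X} {k : ℕ} {ε : ℝ} {P : ℝ × ℝ → X}
    (hx : x ∈ S.sing) (h : IsPolarChart S.sing S.atlas x k ε P) {v : ℂ} (hv : C.IsPrimitive v)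
    {θ : ℝ} (hθ : planePolar ‖v‖ θ = v) :
    ∃ γ : ℝ → X, ContinuousOn γ (Set.Ioo 0 1) ∧
      (∀ t ∈ Set.Ioo (0 : ℝ) 1, C.proj (γ t) = C.q (t * v)) ∧
      ∀ t ∈ Set.Ioo 0 (min 1 (ε / ‖v‖)), γ t = P (t * ‖v‖, θ) := by
  have hv0 : 0 < ‖v‖ := norm_pos_iff.2 hv.ne_zero
  have hm : 0 < min 1 (ε / ‖v‖) := lt_min one_pos (div_pos h.pos hv0)
  have : ContractibleSpace (Set.Ioo (0 : ℝ) 1) :=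
    Convex.contractibleSpace (convex_Ioo (0 : ℝ) 1) ⟨1 / 2, by norm_num⟩
  have : LocallyPathConnectedSpace (Set.Ioo (0 : ℝ) 1) := isOpen_Ioo.locallyPathConnectedSpace
  have hmem : ∀ t ∈ Set.Ioo 0 (min 1 (ε / ‖v‖)), t * ‖v‖ ∈ Set.Ioo 0 ε := fun t ht =>
    ⟨mul_pos ht.1 hv0, (lt_div_iff₀ hv0).1 (lt_min_iff.1 ht.2).2⟩
  have hproj : ∀ t ∈ Set.Ioo 0 (min 1 (ε / ‖v‖)), C.proj (P (t * ‖v‖, θ)) = C.q (t * v) := by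
    intro t ht
    rw [C.proj_polar hx h (Set.Ioo_subset_Ico_self (hmem t ht)), planePolar_eq_smul, mul_smul,
      ← planePolar_eq_smul, hθ, Complex.real_smul]
  set t₀ : ℝ := min 1 (ε / ‖v‖) / 2 with ht₀
  have ht : t₀ ∈ Set.Ioo 0 (min 1 (ε / ‖v‖)) := ⟨by positivity, by linarith⟩
  have hsub : Set.Ioo 0 (min 1 (ε / ‖v‖)) ⊆ Set.Ioo 0 1 :=
    Set.Ioo_subset_Ioo_right (min_le_left _ _)
  -- Primitivity keeps the open segment away from `0`, where the projection is a covering. The base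
  -- point of the lift is taken on the prescribed polar ray, and unique lifting then keeps the lift
  -- on that ray.
  obtain ⟨F, ⟨hF1, hF2⟩, -⟩ := C.isCoveringMapOn_proj.existsUnique_continuousMap_lifts
    (A := Set.Ioo (0 : ℝ) 1) ⟨fun t => C.q ((t : ℝ) * v), C.continuous_q.comp (by fun_prop)⟩
    (a₀ := ⟨t₀, hsub ht⟩) (e₀ := P (t₀ * ‖v‖, θ)) (hproj t₀ ht) (fun t => hv.2 t t.2)
  have hFp : ∀ t, C.proj (F t) = C.q ((t : ℝ) * v) := fun t => congrFun hF2 t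
  let γ : ℝ → X := fun t => if h : t ∈ Set.Ioo (0 : ℝ) 1 then F ⟨t, h⟩ else x
  have hγ : ∀ t (h : t ∈ Set.Ioo (0 : ℝ) 1), γ t = F ⟨t, h⟩ := fun t h => dif_pos h
  have hγc : ContinuousOn γ (Set.Ioo 0 1) := by
    rw [continuousOn_iff_continuous_domRestrict]
    convert! F.continuous using 1
    ext t
    exact hγ t t.2
  have hγp : ∀ t ∈ Set.Ioo (0 : ℝ) 1, C.proj (γ t) = C.q (t * v) := fun t ht => by
    rw [hγ t ht, hFp]
  refine ⟨γ, hγc, hγp, ?_⟩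
  refine C.eqOn_of_lifts isPreconnected_Ioo (hγc.mono hsub) (g := fun t => P (t * ‖v‖, θ)) ?_ ?_
    (fun t ht => h.regular _ (hmem t ht) θ) ?_ ht ?_
  · exact (h.continuousOn_ray θ).comp (by fun_prop) fun t ht =>
      Set.Ioo_subset_Ico_self (hmem t ht)
  · intro t ht
    rw [← C.proj_eq_zero_iff, hγp t (hsub ht)]
    exact hv.2 t (hsub ht)
  · intro t ht
    rw [hγp t (hsub ht), hproj t ht]
  · rw [hγ t₀ (hsub ht), hF1]

/-- Compactness gives a cluster point at the far end; it projects to `0`, so it is singular. Run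
backwards, the path lifts a ray from `0` and clusters at a cone point, hence is a polar ray there
and converges. -/
theorem exists_tendsto (C : TorusCover S G) {v : ℂ} (hv : C.IsPrimitive v) {γ : ℝ → X}
    (hc : ContinuousOn γ (Set.Ioo 0 1))
    (hp : ∀ t ∈ Set.Ioo (0 : ℝ) 1, C.proj (γ t) = C.q (t * v)) :
    ∃ y ∈ S.sing, Tendsto γ (𝓝[<] 1) (𝓝 y) := by
  have := S.compact
  have hrev : Tendsto (fun t : ℝ => 1 - t) (𝓝[>] 0) (𝓝[<] 1) := by
    refine tendsto_nhdsWithin_iff.2 ⟨?_, ?_⟩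
    · have : Tendsto (fun t : ℝ => 1 - t) (𝓝 0) (𝓝 (1 - 0)) := Continuous.tendsto (by fun_prop) 0
      rw [sub_zero] at this
      exact this.mono_left nhdsWithin_le_nhds
    · filter_upwards [self_mem_nhdsWithin] with t ht
      simpa using ht
  have hrev' : Tendsto (fun t : ℝ => 1 - t) (𝓝[<] 1) (𝓝[>] 0) := by
    refine tendsto_nhdsWithin_iff.2 ⟨?_, ?_⟩
    · have : Tendsto (fun t : ℝ => 1 - t) (𝓝 1) (𝓝 (1 - 1)) := Continuous.tendsto (by fun_prop) 1
      rw [sub_self] at this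
      exact this.mono_left nhdsWithin_le_nhds
    · filter_upwards [self_mem_nhdsWithin] with t ht
      simpa using ht
  have hmaps : ∀ t ∈ Set.Ioo (0 : ℝ) 1, 1 - t ∈ Set.Ioo (0 : ℝ) 1 := fun t ht =>
    ⟨by linarith [ht.2], by linarith [ht.1]⟩
  set η : ℝ → X := fun t => γ (1 - t) with hη
  obtain ⟨y, hy⟩ := exists_clusterPt_of_compactSpace (map η (𝓝[>] 0))
  have hηc : ContinuousOn η (Set.Ioo 0 1) := hc.comp (by fun_prop) hmaps
  -- As `v` is in the kernel, the reversed segment has the same image as the ray from `0` in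
  -- direction `-v`.
  have hqv : ∀ t : ℝ, C.q (((1 - t : ℝ) : ℂ) * v) = C.q (t * -v) := by
    intro t
    have : ((1 - t : ℝ) : ℂ) * v = v + t * -v := by push_cast; ring
    rw [this, map_add, hv.1, zero_add]
  have hηp : ∀ t ∈ Set.Ioo (0 : ℝ) 1, C.proj (η t) = C.q (t * -v) := fun t ht => by
    rw [← hqv]
    exact hp _ (hmaps t ht)
  have hys : y ∈ S.sing := by
    rw [← C.proj_eq_zero_iff]
    have h1 : MapClusterPt (C.proj y) (𝓝[>] 0) (C.proj ∘ η) :=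
      MapClusterPt.continuousAt_comp C.continuous_proj.continuousAt hy
    have h2 : Tendsto (C.proj ∘ η) (𝓝[>] 0) (𝓝 0) := by
      have h3 : Tendsto (fun t : ℝ => C.q (t * -v)) (𝓝 0) (𝓝 (C.q ((0 : ℝ) * -v))) :=
        (C.continuous_q.comp (by fun_prop : Continuous fun t : ℝ => (t : ℂ) * -v)).tendsto 0
      simp only [Complex.ofReal_zero, zero_mul, map_zero] at h3
      refine (h3.mono_left nhdsWithin_le_nhds).congr' ?_
      filter_upwards [Ioo_mem_nhdsGT (zero_lt_one' ℝ)] with t ht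
      exact (hηp t ht).symm
    by_contra hne
    obtain ⟨U, V, hU, hV, h0, h3, hd⟩ := t2_separation hne
    obtain ⟨t, h4, h5⟩ := ((mapClusterPt_iff_frequently.1 h1 U (hU.mem_nhds h0)).and_eventually
      (h2.eventually (hV.mem_nhds h3))).exists
    exact Set.disjoint_left.1 hd h4 h5
  refine ⟨y, hys, ?_⟩
  obtain ⟨k, ε, Q, hQ⟩ := S.cone y hys
  have hv0 : 0 < ‖-v‖ := norm_pos_iff.2 (neg_ne_zero.2 hv.ne_zero)
  obtain ⟨ψ, -, hψ⟩ := C.exists_eq_polar hys hQ one_pos (neg_ne_zero.2 hv.ne_zero) hηc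
    (fun t ht => by
      rw [← C.proj_eq_zero_iff, hηp t ht, ← hqv]
      exact hv.2 _ (hmaps t ht)) hηp hy
  have h1 : Tendsto η (𝓝[>] 0) (𝓝 y) := by
    have h2 : Tendsto (fun r => Q (r, ψ)) (𝓝[Set.Ico 0 ε] 0) (𝓝 y) := by
      have h3 := hQ.continuousOn_ray ψ 0 ⟨le_rfl, hQ.pos⟩
      rwa [ContinuousWithinAt, hQ.apex] at h3
    have h4 : Tendsto (fun t : ℝ => t * ‖-v‖) (𝓝[>] 0) (𝓝[Set.Ico 0 ε] 0) := by
      refine tendsto_nhdsWithin_iff.2 ⟨?_, ?_⟩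
      · have : Tendsto (fun t : ℝ => t * ‖-v‖) (𝓝 0) (𝓝 (0 * ‖-v‖)) :=
          Continuous.tendsto (by fun_prop) 0
        rw [zero_mul] at this
        exact this.mono_left nhdsWithin_le_nhds
      · filter_upwards [Ioo_mem_nhdsGT (div_pos hQ.pos hv0)] with t ht
        exact ⟨(mul_pos ht.1 hv0).le, (lt_div_iff₀ hv0).1 ht.2⟩
    refine (h2.comp h4).congr' ?_
    filter_upwards [Ioo_mem_nhdsGT (lt_min one_pos (div_pos hQ.pos hv0))] with t ht
    exact (hψ t ht).symm
  refine (h1.comp hrev').congr fun t => ?_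
  simp [hη]

/-- There is a saddle connection with a given primitive holonomy vector and a given germ. -/
theorem exists_saddleConnection (C : TorusCover S G) {x : X} {k : ℕ} {ε : ℝ} {P : ℝ × ℝ → X}
    (hx : x ∈ S.sing) (h : IsPolarChart S.sing S.atlas x k ε P) {v : ℂ} (hv : C.IsPrimitive v)
    {θ : ℝ} (hθ : planePolar ‖v‖ θ = v) :
    ∃ s : S.SaddleConnection, s.initial = x ∧ s.hol = v ∧ s.LeavesAlong P θ := by
  have := S.compact
  have := S.hausdorff
  have hv0 : 0 < ‖v‖ := norm_pos_iff.2 hv.ne_zero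
  have hm : 0 < min 1 (ε / ‖v‖) := lt_min one_pos (div_pos h.pos hv0)
  obtain ⟨γ, hc, hp, hγP⟩ := C.exists_lift hx h hv hθ
  obtain ⟨y, hy, hty⟩ := C.exists_tendsto hv hc hp
  have htx : Tendsto γ (𝓝[>] 0) (𝓝 x) := by
    have h2 : Tendsto (fun r => P (r, θ)) (𝓝[Set.Ico 0 ε] 0) (𝓝 x) := by
      have h3 := h.continuousOn_ray θ 0 ⟨le_rfl, h.pos⟩
      rwa [ContinuousWithinAt, h.apex] at h3
    have h4 : Tendsto (fun t : ℝ => t * ‖v‖) (𝓝[>] 0) (𝓝[Set.Ico 0 ε] 0) := by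
      refine tendsto_nhdsWithin_iff.2 ⟨?_, ?_⟩
      · have : Tendsto (fun t : ℝ => t * ‖v‖) (𝓝 0) (𝓝 (0 * ‖v‖)) :=
          Continuous.tendsto (by fun_prop) 0
        rw [zero_mul] at this
        exact this.mono_left nhdsWithin_le_nhds
      · filter_upwards [Ioo_mem_nhdsGT (div_pos h.pos hv0)] with t ht
        exact ⟨(mul_pos ht.1 hv0).le, (lt_div_iff₀ hv0).1 ht.2⟩
    refine (h2.comp h4).congr' ?_
    filter_upwards [Ioo_mem_nhdsGT hm] with t ht
    exact (hγP t ht).symm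
  set η : ℝ → X := extendFrom (Set.Ioo 0 1) γ with hη
  have hηc : ContinuousOn η (Set.Icc 0 1) := continuousOn_Icc_extendFrom_Ioo hc htx hty
  have hη0 : η 0 = x := eq_lim_at_left_extendFrom_Ioo zero_lt_one htx
  have hη1 : η 1 = y := eq_lim_at_right_extendFrom_Ioo zero_lt_one hty
  have hηγ : ∀ t ∈ Set.Ioo (0 : ℝ) 1, η t = γ t := fun t ht =>
    extendFrom_extends hc t ht
  have hηp : ∀ t ∈ Set.Ioo (0 : ℝ) 1, C.proj (η t) = C.q (t * v) := fun t ht => by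
    rw [hηγ t ht, hp t ht]
  refine ⟨⟨⟨fun t => η t, continuousOn_iff_continuous_domRestrict.1 hηc⟩, v, hv.ne_zero, ?_, ?_, ?_, ?_⟩,
    ?_, rfl, ?_⟩
  · change η 0 ∈ S.sing
    rwa [hη0]
  · change η 1 ∈ S.sing
    rwa [hη1]
  · intro t h0 h1
    rw [← C.proj_eq_zero_iff]
    exact fun h => hv.2 t ⟨h0, h1⟩ (by rw [← hηp t ⟨h0, h1⟩]; exact h)
  · intro t h0 h1 φ hφ ht
    have h2 := C.eventually_straight (γ := η) (v := v)
      (hηc.continuousAt (Icc_mem_nhds (show (0 : ℝ) < t from h0) (show (t : ℝ) < 1 from h1)))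
      (by filter_upwards [Ioo_mem_nhds (show (0 : ℝ) < t from h0) (show (t : ℝ) < 1 from h1)]
            with u hu using hηp u hu) φ hφ ht
    exact (continuous_subtype_val.tendsto t).eventually h2
  · exact hη0
  · refine TranslationSurface.SaddleConnection.eventually_nhdsGT_zero (p := fun t => η t = P (t * ‖v‖, θ)) hm
      fun t ht => ?_
    rw [hηγ t ⟨ht.1, ht.2.trans_le (min_le_left _ _)⟩, hγP t ht]

end TorusCover

/-! ### Angles of a direction, and representatives of residues. -/

theorem planePolar_arg (v : ℂ) (j : ℤ) : planePolar ‖v‖ (v.arg + 2 * Real.pi * j) = v := by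
  have h : Complex.exp (((v.arg + 2 * Real.pi * j : ℝ) : ℂ) * Complex.I) =
      Complex.exp (v.arg * Complex.I) := by
    rw [Complex.exp_eq_exp_iff_exists_int]
    refine ⟨j, ?_⟩
    push_cast
    ring
  rw [planePolar, h, Complex.norm_mul_exp_arg_mul_I]

theorem exists_eq_arg_of_planePolar {v : ℂ} (hv : v ≠ 0) {θ : ℝ} (h : planePolar ‖v‖ θ = v) :
    ∃ j : ℤ, θ = v.arg + 2 * Real.pi * j := by
  have h1 := h.trans (Complex.norm_mul_exp_arg_mul_I v).symm
  rw [planePolar] at h1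
  have h2 := mul_left_cancel₀ (by exact_mod_cast norm_ne_zero_iff.2 hv) h1
  obtain ⟨j, hj⟩ := Complex.exp_eq_exp_iff_exists_int.1 h2
  refine ⟨j, ?_⟩
  have h3 := congrArg Complex.im hj
  simp at h3
  linarith

namespace ZMod

theorem exists_intCast_le (k : ℕ) (z : ZMod (k + 1)) :
    ∃ N : ℤ, (N : ZMod (k + 1)) = z ∧ 0 ≤ N ∧ N ≤ k :=
  ⟨z.val, by simp, by positivity, by have := z.val_lt; omega⟩

/-- The integers from `0` to `k` represent each residue once, so an interval with one end removed
misses exactly the residue of that end; here `k` represents `-1`. -/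
theorem exists_intCast_lt_iff (k : ℕ) (z : ZMod (k + 1)) :
    (∃ N : ℤ, (N : ZMod (k + 1)) = z ∧ 0 ≤ N ∧ N < k) ↔ z ≠ -1 := by
  have h : ∀ N : ℤ, (N : ZMod (k + 1)) = -1 ↔ ((k + 1 : ℕ) : ℤ) ∣ N + 1 := fun N => by
    rw [← ZMod.intCast_zmod_eq_zero_iff_dvd, Int.cast_add, Int.cast_one, eq_neg_iff_add_eq_zero]
  constructor
  · rintro ⟨N, rfl, h0, h1⟩ hN
    have := Int.le_of_dvd (by omega) ((h N).1 hN)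
    push_cast at this
    omega
  · intro hz
    obtain ⟨N, rfl, h0, h1⟩ := exists_intCast_le k z
    refine ⟨N, rfl, h0, lt_of_le_of_ne h1 ?_⟩
    rintro rfl
    exact hz ((h _).2 (by push_cast; exact dvd_rfl))

theorem exists_intCast_pos_iff (k : ℕ) (z : ZMod (k + 1)) :
    (∃ N : ℤ, (N : ZMod (k + 1)) = z ∧ 0 < N ∧ N ≤ k) ↔ z ≠ 0 := by
  constructor
  · rintro ⟨N, rfl, h0, h1⟩ hN
    have := Int.le_of_dvd h0 ((ZMod.intCast_zmod_eq_zero_iff_dvd N (k + 1)).1 hN)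
    push_cast at this
    omega
  · intro hz
    obtain ⟨N, rfl, h0, h1⟩ := exists_intCast_le k z
    refine ⟨N, rfl, lt_of_le_of_ne h0 ?_, h1⟩
    rintro rfl
    simp at hz

end ZMod

/-! ### Angles between consecutive saddle connections. -/

namespace TranslationSurface.SaddleConnection

variable {X : Type*} [TopologicalSpace X] {S : TranslationSurface X}
  {G : Type*} [AddCommGroup G] [TopologicalSpace G] [IsTopologicalAddGroup G] [T2Space G]
  (C : TorusCover S G) {s t : S.SaddleConnection}

theorem ArrivesAlong.iff {x : X} {k : ℕ} {ε : ℝ} {P : ℝ × ℝ → X} {θ θ' : ℝ}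
    (h : s.ArrivesAlong P θ) (hP : IsPolarChart S.sing S.atlas x k ε P) :
    s.ArrivesAlong P θ' ↔ ∃ j : ℤ, θ' = θ + j * (2 * Real.pi * (k + 1)) := by
  rw [arrivesAlong_iff] at h ⊢
  exact h.iff hP

include C in
-- The reversed saddle connection leaves in direction `-hol`, hence the extra `π`.
theorem exists_arrivesAlong (s : S.SaddleConnection) {k : ℕ} {ε : ℝ} {P : ℝ × ℝ → X}
    (hP : IsPolarChart S.sing S.atlas s.terminal k ε P) :
    ∃ i : ℤ, s.ArrivesAlong P (s.hol.arg + Real.pi + 2 * Real.pi * i) := by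
  have hP' : IsPolarChart S.sing S.atlas s.reverse.initial k ε P := by
    have : s.reverse.initial = s.terminal := by simp [reverse, initial, terminal]
    rwa [this]
  obtain ⟨θ, h1, h2⟩ := s.reverse.exists_leavesAlong C hP'
  have h3 : planePolar ‖s.hol‖ (θ - Real.pi) = s.hol := by
    have h4 : planePolar ‖s.hol‖ θ = -s.hol := by simpa [reverse] using h1
    have h5 : Complex.exp (((θ - Real.pi : ℝ) : ℂ) * Complex.I) = -Complex.exp (θ * Complex.I) := by
      push_cast
      rw [sub_mul, Complex.exp_sub, Complex.exp_pi_mul_I]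
      ring
    rw [planePolar] at h4 ⊢
    rw [h5, mul_neg, h4, neg_neg]
  obtain ⟨i, hi⟩ := exists_eq_arg_of_planePolar s.hol_ne_zero h3
  refine ⟨i, (s.arrivesAlong_iff).2 ?_⟩
  convert h2 using 1
  linarith

include C in
-- The definition quantifies over all polar charts. Two of them differ by a rotation, which cancels
-- in the angle, so any one chart may be used.
theorem hasClockwiseAngle_iff {k : ℕ} {ε : ℝ} {P : ℝ × ℝ → X} {θ θ' : ℝ}
    (hP : IsPolarChart S.sing S.atlas s.terminal k ε P) (hs : s.ArrivesAlong P θ)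
    (ht : t.LeavesAlong P θ') (α : ℝ) :
    s.HasClockwiseAngle t α ↔ s.terminal = t.initial ∧ 0 ≤ α ∧ α < 2 * Real.pi * (k + 1) ∧
      ∃ m : ℤ, θ - α = θ' + m * (2 * Real.pi * (k + 1)) := by
  refine and_congr_right fun _ => ⟨?_, ?_⟩
  · rintro ⟨k', ε', P', ψ, hP', hs', ht', h0, h1⟩
    obtain ⟨rfl, c, hc⟩ := C.exists_polar_rotation s.terminal_mem hP hP'
    have hm : 0 < min ε ε' := lt_min hP.pos hP'.pos
    refine ⟨h0, h1, ?_⟩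
    have hs2 : s.ArrivesAlong P (ψ + c) := by
      rw [arrivesAlong_iff] at hs' ⊢
      exact hs'.comp hm fun r hr => (hc r hr _).symm
    have ht2 : t.LeavesAlong P (ψ - α + c) := ht'.comp hm fun r hr => (hc r hr _).symm
    obtain ⟨i, hi⟩ := (hs.iff hP).1 hs2
    obtain ⟨j, hj⟩ := (ht.iff hP).1 ht2
    refine ⟨j - i, ?_⟩
    push_cast
    linarith
  · rintro ⟨h0, h1, m, hm⟩
    exact ⟨k, ε, P, θ, hP, hs, (ht.iff hP).2 ⟨m, hm⟩, h0, h1⟩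

include C in
theorem hasAnticlockwiseAngle_iff {k : ℕ} {ε : ℝ} {P : ℝ × ℝ → X} {θ θ' : ℝ}
    (hP : IsPolarChart S.sing S.atlas s.terminal k ε P) (hs : s.ArrivesAlong P θ)
    (ht : t.LeavesAlong P θ') (α : ℝ) :
    s.HasAnticlockwiseAngle t α ↔ s.terminal = t.initial ∧ 0 ≤ α ∧ α < 2 * Real.pi * (k + 1) ∧
      ∃ m : ℤ, θ + α = θ' + m * (2 * Real.pi * (k + 1)) := by
  refine and_congr_right fun _ => ⟨?_, ?_⟩
  · rintro ⟨k', ε', P', ψ, hP', hs', ht', h0, h1⟩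
    obtain ⟨rfl, c, hc⟩ := C.exists_polar_rotation s.terminal_mem hP hP'
    have hm : 0 < min ε ε' := lt_min hP.pos hP'.pos
    refine ⟨h0, h1, ?_⟩
    have hs2 : s.ArrivesAlong P (ψ + c) := by
      rw [arrivesAlong_iff] at hs' ⊢
      exact hs'.comp hm fun r hr => (hc r hr _).symm
    have ht2 : t.LeavesAlong P (ψ + α + c) := ht'.comp hm fun r hr => (hc r hr _).symm
    obtain ⟨i, hi⟩ := (hs.iff hP).1 hs2
    obtain ⟨j, hj⟩ := (ht.iff hP).1 ht2
    refine ⟨j - i, ?_⟩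
    push_cast
    linarith
  · rintro ⟨h0, h1, m, hm⟩
    exact ⟨k, ε, P, θ, hP, hs, (ht.iff hP).2 ⟨m, hm⟩, h0, h1⟩

include C in
-- The clockwise and anticlockwise angles sum to a multiple of the cone angle that lies strictly
-- between zero and twice the cone angle, hence to the cone angle itself. Both being at least `π`
-- then confines the clockwise angle minus `π` to `[0, 2πk]`.
theorem geodesicTurn_iff {k : ℕ} {ε : ℝ} {P : ℝ × ℝ → X} {θ θ' : ℝ}
    (hP : IsPolarChart S.sing S.atlas s.terminal k ε P) (hs : s.ArrivesAlong P θ)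
    (ht : t.LeavesAlong P θ') :
    s.GeodesicTurn t ↔ s.terminal = t.initial ∧
      ∃ m : ℤ, 0 ≤ θ - Real.pi - θ' - m * (2 * Real.pi * (k + 1)) ∧
        θ - Real.pi - θ' - m * (2 * Real.pi * (k + 1)) ≤ 2 * Real.pi * k := by
  have hpi := Real.pi_pos
  have hK : 0 < 2 * Real.pi * (k + 1) := by positivity
  simp only [GeodesicTurn, hasClockwiseAngle_iff C hP hs ht, hasAnticlockwiseAngle_iff C hP hs ht]
  constructor
  · rintro ⟨α, β, ⟨h, -, h1, m, hm⟩, ⟨-, -, h2, m', hm'⟩, h3, h4⟩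
    refine ⟨h, m, by linarith, ?_⟩
    have h5 : α + β = ((m' - m : ℤ) : ℝ) * (2 * Real.pi * (k + 1)) := by push_cast; linarith
    have h6 : (0 : ℝ) < ((m' - m : ℤ) : ℝ) := by
      by_contra! h
      nlinarith
    have h7 : ((m' - m : ℤ) : ℝ) < 2 := by
      by_contra! h
      nlinarith
    have h8 : m' - m = 1 := by
      have h9 : 0 < m' - m := by exact_mod_cast h6
      have h10 : m' - m < 2 := by exact_mod_cast h7
      omega
    rw [h8] at h5
    push_cast at h5
    linarith
  · rintro ⟨h, m, h1, h2⟩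
    refine ⟨θ - θ' - m * (2 * Real.pi * (k + 1)),
      2 * Real.pi * (k + 1) - (θ - θ' - m * (2 * Real.pi * (k + 1))),
      ⟨h, by linarith, by linarith, m, by ring⟩, ⟨h, by linarith, by linarith, m + 1, ?_⟩,
      by linarith, by linarith⟩
    push_cast
    ring

end TranslationSurface.SaddleConnection

/-! ### Coordinates for saddle connections, and counting of turns. -/

namespace TorusCover

variable {X : Type*} [TopologicalSpace X] {S : TranslationSurface X}
  {G : Type*} [AddCommGroup G] [TopologicalSpace G] [IsTopologicalAddGroup G] [T2Space G]
  (C : TorusCover S G) {k : ℕ} {ε : X → ℝ} {P : X → ℝ × ℝ → X}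
  (hP : ∀ x ∈ S.sing, IsPolarChart S.sing S.atlas x k (ε x) (P x))

/-- The saddle connection with given initial point and holonomy vector, whose direction has a
given position in the polar coordinates at the initial point. -/
noncomputable def connection (x : S.sing) (j : ZMod (k + 1)) (v : {v // C.IsPrimitive v}) :
    S.SaddleConnection :=
  (C.exists_saddleConnection x.2 (hP x x.2) v.2 (planePolar_arg v (j.cast : ℤ))).choose

variable (x : S.sing) (j : ZMod (k + 1)) (v : {v // C.IsPrimitive v})

theorem connection_initial : (C.connection hP x j v).initial = x :=
  (C.exists_saddleConnection x.2 (hP x x.2) v.2 (planePolar_arg v (j.cast : ℤ))).choose_spec.1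

theorem connection_hol : (C.connection hP x j v).hol = v :=
  (C.exists_saddleConnection x.2 (hP x x.2) v.2 (planePolar_arg v (j.cast : ℤ))).choose_spec.2.1

theorem connection_leavesAlong (i : ℤ) (hi : (i : ZMod (k + 1)) = j) :
    (C.connection hP x j v).LeavesAlong (P x) ((v : ℂ).arg + 2 * Real.pi * i) := by
  refine ((C.exists_saddleConnection x.2 (hP x x.2) v.2
    (planePolar_arg v (j.cast : ℤ))).choose_spec.2.2.iff (hP x x.2)).2 ?_
  have h : ((j.cast : ℤ) : ZMod (k + 1)) = (i : ZMod (k + 1)) := by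
    rw [ZMod.intCast_zmod_cast, hi]
  obtain ⟨m, hm⟩ := (ZMod.intCast_eq_intCast_iff_dvd_sub _ _ _).1 h
  refine ⟨m, ?_⟩
  rw [sub_eq_iff_eq_add.1 hm]
  push_cast
  ring

/-- A saddle connection is fixed by holonomy and germ. The angles of a given direction are `arg +
2πi`, and modulo `2π(k+1)` only the residue of `i` matters. -/
theorem connection_bijective :
    Function.Bijective (fun p : S.sing × ZMod (k + 1) × {v // C.IsPrimitive v} =>
      C.connection hP p.1 p.2.1 p.2.2) := by
  constructor
  · rintro ⟨x, j, v⟩ ⟨y, j', w⟩ h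
    simp only at h
    obtain rfl : x = y := Subtype.ext (by
      rw [← C.connection_initial hP x j v, h, C.connection_initial])
    obtain rfl : v = w := Subtype.ext (by
      rw [← C.connection_hol hP x j v, h, C.connection_hol])
    have h1 := C.connection_leavesAlong hP x j v (j.cast : ℤ) (by simp)
    have h2 := C.connection_leavesAlong hP x j' v (j'.cast : ℤ) (by simp)
    rw [← h, h1.iff (hP x x.2)] at h2
    obtain ⟨m, hm⟩ := h2
    have h3 : ((j'.cast : ℤ) : ℝ) = ((j.cast + m * (k + 1) : ℤ) : ℝ) := by
      push_cast
      have hpi := Real.pi_pos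
      have : 2 * Real.pi * (((j'.cast : ℤ) : ℝ) - ((j.cast : ℤ) : ℝ) - m * (k + 1)) = 0 := by
        linarith
      rcases mul_eq_zero.1 this with h | h <;> linarith
    have h4 := congrArg (Int.cast : ℤ → ZMod (k + 1)) (Int.cast_injective h3)
    push_cast at h4
    have h5 : ((k : ZMod (k + 1)) + 1) = 0 := by exact_mod_cast ZMod.natCast_self (k + 1)
    rw [h5] at h4
    simp at h4
    rw [h4]
  · intro s
    obtain ⟨θ, h1, h2⟩ := s.exists_leavesAlong C (hP s.initial s.initial_mem)
    obtain ⟨i, rfl⟩ := exists_eq_arg_of_planePolar s.hol_ne_zero h1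
    refine ⟨⟨⟨s.initial, s.initial_mem⟩, i, ⟨s.hol, s.isPrimitive_hol C⟩⟩, ?_⟩
    exact TranslationSurface.SaddleConnection.ext_of_leavesAlong C
      (C.connection_leavesAlong hP _ _ _ i rfl) h2 (C.connection_hol hP _ _ _)

variable {C}

theorem arg_sub_arg_lt (u w : ℂ) : |(u.arg - w.arg) / (2 * Real.pi)| < 1 := by
  have hpi := Real.pi_pos
  rw [abs_div, abs_of_pos (by positivity : 0 < 2 * Real.pi), div_lt_one (by positivity), abs_lt]
  constructor <;> linarith [u.neg_pi_lt_arg, u.arg_le_pi, w.neg_pi_lt_arg, w.arg_le_pi]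

variable {s : S.SaddleConnection} {i : ℤ}

/-- Two arguments differ by less than `2π`, so equality of the angles modulo `2π(k+1)` forces the
arguments and the residues to agree separately. -/
theorem hasClockwiseAngle_connection_iff
    (hs : s.ArrivesAlong (P s.terminal) (s.hol.arg + Real.pi + 2 * Real.pi * i)) :
    s.HasClockwiseAngle (C.connection hP x j v) Real.pi ↔
      s.terminal = x ∧ s.hol.arg = (v : ℂ).arg ∧ (i : ZMod (k + 1)) = j := by
  have hpi := Real.pi_pos
  have hI := C.connection_initial hP x j v
  by_cases hx : s.terminal = x
  swap
  · constructor
    · intro h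
      exact absurd (h.1.trans hI) hx
    · exact fun h => absurd h.1 hx
  have hl := C.connection_leavesAlong hP x j v (j.cast : ℤ) (by simp)
  rw [← hx] at hl
  rw [TranslationSurface.SaddleConnection.hasClockwiseAngle_iff C (hP _ s.terminal_mem) hs hl, hI]
  simp only [hx, true_and]
  have habs := abs_lt.1 (arg_sub_arg_lt s.hol v)
  constructor
  · rintro ⟨-, -, m, hm⟩
    have h1 : (s.hol.arg - (v : ℂ).arg) / (2 * Real.pi) =
        ((j.cast - i + m * (k + 1) : ℤ) : ℝ) := by
      rw [div_eq_iff (by positivity)]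
      push_cast
      linarith
    rw [h1] at habs
    have h2 : (j.cast - i + m * (k + 1) : ℤ) = 0 := by
      have h3 : -1 < (j.cast - i + m * (k + 1) : ℤ) := by exact_mod_cast habs.1
      have h4 : (j.cast - i + m * (k + 1) : ℤ) < 1 := by exact_mod_cast habs.2
      omega
    rw [h2, Int.cast_zero, div_eq_zero_iff] at h1
    refine ⟨by rcases h1 with h | h <;> linarith, ?_⟩
    have h5 := congrArg (Int.cast : ℤ → ZMod (k + 1)) h2
    push_cast at h5
    have h6 : ((k : ZMod (k + 1)) + 1) = 0 := by exact_mod_cast ZMod.natCast_self (k + 1)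
    rw [h6] at h5
    simp at h5
    exact (sub_eq_zero.1 h5).symm
  · rintro ⟨h1, h2⟩
    have h3 : ((j.cast : ℤ) : ZMod (k + 1)) = (i : ZMod (k + 1)) := by
      rw [ZMod.intCast_zmod_cast, h2]
    obtain ⟨m, hm⟩ := (ZMod.intCast_eq_intCast_iff_dvd_sub _ _ _).1 h3
    refine ⟨hpi.le, ?_, m, ?_⟩
    · have : (0 : ℝ) ≤ k := by positivity
      nlinarith
    · rw [h1, sub_eq_iff_eq_add.1 hm]
      push_cast
      ring

/-- The quantity bounded between `0` and `k` is the clockwise angle minus `π`, in units of `2π`; `N`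
collects its full turns. -/
theorem geodesicTurn_connection_iff
    (hs : s.ArrivesAlong (P s.terminal) (s.hol.arg + Real.pi + 2 * Real.pi * i)) :
    s.GeodesicTurn (C.connection hP x j v) ↔ s.terminal = x ∧ ∃ N : ℤ,
      (N : ZMod (k + 1)) = i - j ∧ 0 ≤ (s.hol.arg - (v : ℂ).arg) / (2 * Real.pi) + N ∧
        (s.hol.arg - (v : ℂ).arg) / (2 * Real.pi) + N ≤ k := by
  have hpi := Real.pi_pos
  have hI := C.connection_initial hP x j v
  by_cases hx : s.terminal = x
  swap
  · constructor
    · rintro ⟨_, _, h, -⟩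
      exact absurd (h.1.trans hI) hx
    · exact fun h => absurd h.1 hx
  have hl := C.connection_leavesAlong hP x j v (j.cast : ℤ) (by simp)
  rw [← hx] at hl
  rw [TranslationSurface.SaddleConnection.geodesicTurn_iff C (hP _ s.terminal_mem) hs hl, hI]
  simp only [hx, true_and]
  have key : ∀ N : ℤ, (s.hol.arg - (v : ℂ).arg) / (2 * Real.pi) + N =
      (s.hol.arg - (v : ℂ).arg + 2 * Real.pi * N) / (2 * Real.pi) := fun N => by
    field_simp
  constructor
  · rintro ⟨m, h1, h2⟩
    refine ⟨i - j.cast - m * (k + 1), ?_, ?_, ?_⟩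
    · have h6 : ((k : ZMod (k + 1)) + 1) = 0 := by exact_mod_cast ZMod.natCast_self (k + 1)
      push_cast
      rw [h6]
      simp
    · rw [key]
      refine div_nonneg ?_ (by positivity)
      push_cast
      linarith
    · rw [key, div_le_iff₀ (by positivity)]
      push_cast
      linarith
  · rintro ⟨N, h1, h2, h3⟩
    rw [key] at h2 h3
    rw [div_le_iff₀ (by positivity)] at h3
    rw [le_div_iff₀ (by positivity)] at h2
    have h4 : ((N : ℤ) : ZMod (k + 1)) = ((i - j.cast : ℤ) : ZMod (k + 1)) := by
      rw [h1]
      simp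
    obtain ⟨m, hm⟩ := (ZMod.intCast_eq_intCast_iff_dvd_sub _ _ _).1 h4
    have hm' : ((i : ℝ) - (j.cast : ℤ)) - N = (k + 1) * m := by exact_mod_cast hm
    have h5 : 2 * Real.pi * N = 2 * Real.pi * i - 2 * Real.pi * (j.cast : ℤ)
        - m * (2 * Real.pi * (k + 1)) := by linear_combination (-2 * Real.pi) * hm'
    exact ⟨m, by linarith, by linarith⟩

/-- The geodesic continuations of a saddle connection in a given direction, other than the
straight one, avoid exactly one of the possible positions. -/
theorem exists_turn_iff (s : S.SaddleConnection) (v : {v // C.IsPrimitive v}) :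
    ∃ c : ZMod (k + 1), ∀ (x : S.sing) (j : ZMod (k + 1)),
      (s.GeodesicTurn (C.connection hP x j v) ∧
        ¬ s.HasClockwiseAngle (C.connection hP x j v) Real.pi) ↔ s.terminal = x ∧ j ≠ c := by
  have hpi := Real.pi_pos
  obtain ⟨i, hs⟩ := s.exists_arrivesAlong C (hP _ s.terminal_mem)
  simp only [geodesicTurn_connection_iff hP _ _ v hs, hasClockwiseAngle_connection_iff hP _ _ v hs]
  set δ := (s.hol.arg - (v : ℂ).arg) / (2 * Real.pi) with hδ
  have hlt := abs_lt.1 (arg_sub_arg_lt s.hol v)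
  rw [← hδ] at hlt
  have h0 : s.hol.arg = (v : ℂ).arg ↔ δ = 0 := by
    rw [hδ, div_eq_zero_iff, sub_eq_zero]
    simp [hpi.ne']
  simp only [h0]
  -- Since `|δ| < 1`, the admissible `N` are `1, …, k` if `δ < 0`, `0, …, k` if `δ = 0`, and `0, …,
  -- k-1` if `δ > 0`. For `δ < 0` this excludes `j = i`, for `δ > 0` it excludes `j = i + 1`; for `δ
  -- = 0` nothing is excluded, but the straight continuation `j = i` is discarded.
  rcases lt_trichotomy δ 0 with h | h | h
  · refine ⟨i, fun x j => ?_⟩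
    have h1 : ∀ N : ℤ, (0 ≤ δ + N ↔ 0 < N) := fun N => by
      constructor
      · intro h2
        have : (0 : ℝ) < N := by linarith
        exact_mod_cast this
      · intro h2
        have : (1 : ℝ) ≤ N := by exact_mod_cast h2
        linarith
    have h2 : ∀ N : ℤ, (δ + N ≤ k ↔ N ≤ k) := fun N => by
      constructor
      · intro h2
        have : (N : ℝ) < ((k + 1 : ℤ) : ℝ) := by push_cast; linarith
        have : N < k + 1 := by exact_mod_cast this
        omega
      · intro h2
        have : (N : ℝ) ≤ k := by exact_mod_cast h2
        linarith
    simp only [h1, h2, ZMod.exists_intCast_pos_iff, h.ne, false_and, and_false, not_false_eq_true,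
      and_true, ne_eq, sub_eq_zero, eq_comm (a := j)]
  · refine ⟨i, fun x j => ?_⟩
    have h1 : ∃ N : ℤ, (N : ZMod (k + 1)) = i - j ∧ 0 ≤ δ + N ∧ δ + N ≤ k := by
      obtain ⟨N, h1, h2, h3⟩ := ZMod.exists_intCast_le k ((i : ZMod (k + 1)) - j)
      refine ⟨N, h1, ?_, ?_⟩ <;> rw [h, zero_add] <;> exact_mod_cast ‹_›
    simp only [h, true_and, eq_comm (a := j), ne_eq] at h1 ⊢
    tauto
  · refine ⟨i + 1, fun x j => ?_⟩
    have h1 : ∀ N : ℤ, (0 ≤ δ + N ↔ 0 ≤ N) := fun N => by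
      constructor
      · intro h2
        have : ((-1 : ℤ) : ℝ) < N := by push_cast; linarith
        have : -1 < N := by exact_mod_cast this
        omega
      · intro h2
        have : (0 : ℝ) ≤ N := by exact_mod_cast h2
        linarith
    have h2 : ∀ N : ℤ, (δ + N ≤ k ↔ N < k) := fun N => by
      constructor
      · intro h2
        have : (N : ℝ) < k := by linarith
        exact_mod_cast this
      · intro h2
        have h3 : N + 1 ≤ k := h2
        have : (N : ℝ) + 1 ≤ k := by exact_mod_cast h3
        linarith
    have h3 : (i : ZMod (k + 1)) - j = -1 ↔ j = i + 1 := by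
      constructor <;> intro h <;> linear_combination -h
    simp only [h1, h2, ZMod.exists_intCast_lt_iff, h.ne', false_and, and_false, not_false_eq_true,
      and_true, ne_eq, h3]

include C hP in
-- Clockwise angle `π` preserves the direction, primitivity then fixes the holonomy, and the residue
-- is forced. This makes the straight continuation a function.
theorem exists_next (s : S.SaddleConnection) :
    ∃ s' : S.SaddleConnection, (∀ t, s.HasClockwiseAngle t Real.pi ↔ t = s') ∧ s'.hol = s.hol ∧
      s.GeodesicTurn s' := by
  obtain ⟨i, hs⟩ := s.exists_arrivesAlong C (hP _ s.terminal_mem)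
  set v : {v // C.IsPrimitive v} := ⟨s.hol, s.isPrimitive_hol C⟩ with hv
  refine ⟨C.connection hP ⟨s.terminal, s.terminal_mem⟩ i v, ?_, C.connection_hol hP _ _ _, ?_⟩
  · intro t
    obtain ⟨⟨x, j, w⟩, rfl⟩ := (C.connection_bijective hP).2 t
    simp only
    rw [hasClockwiseAngle_connection_iff hP _ _ _ hs]
    constructor
    · rintro ⟨h1, h2, rfl⟩
      obtain rfl : x = ⟨s.terminal, s.terminal_mem⟩ := Subtype.ext h1.symm
      have h3 : w = v := Subtype.ext (w.2.eq_of_planePolar v.2 (θ := (w : ℂ).arg)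
        (by simpa using planePolar_arg w 0) (by
          rw [← h2]
          simpa using planePolar_arg s.hol 0))
      rw [h3]
    · intro h
      have h1 := (C.connection_bijective hP).1 (a₁ := (x, j, w))
        (a₂ := (⟨s.terminal, s.terminal_mem⟩, (i : ZMod (k + 1)), v)) h
      simp only [Prod.mk.injEq] at h1
      obtain ⟨rfl, rfl, rfl⟩ := h1
      exact ⟨rfl, rfl, rfl⟩
  · rw [geodesicTurn_connection_iff hP _ _ _ hs]
    refine ⟨rfl, 0, by simp, ?_, ?_⟩ <;> simp [hv]

end TorusCover

/-! ### The square torus. -/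

/-- The projection of the plane to the square torus with sides of length `a`. -/
noncomputable def toTorus (a : ℝ) : ℂ →+ AddCircle a × AddCircle a where
  toFun z := (z.re, z.im)
  map_zero' := by simp
  map_add' z w := by simp

theorem isLocalHomeomorph_toTorus (a : ℝ) : IsLocalHomeomorph (toTorus a) := by
  intro z
  obtain ⟨e, he, hee⟩ := AddCircle.isLocalHomeomorph_coe a z.re
  obtain ⟨e', he', hee'⟩ := AddCircle.isLocalHomeomorph_coe a z.im
  refine ⟨Complex.equivRealProdCLM.toHomeomorph.toOpenPartialHomeomorph.trans (e.prod e'), ?_, ?_⟩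
  · simpa using ⟨he, he'⟩
  · ext w
    · change _ = e w.re
      rw [← hee]
      rfl
    · change _ = e' w.im
      rw [← hee']
      rfl

theorem toTorus_eq_zero_iff {a : ℝ} {z : ℂ} :
    toTorus a z = 0 ↔ ∃ m n : ℤ, z = ⟨m * a, n * a⟩ := by
  change ((z.re : AddCircle a), (z.im : AddCircle a)) = ((0 : AddCircle a), (0 : AddCircle a)) ↔ _
  simp only [Prod.mk.injEq, AddCircle.coe_eq_zero_iff, zsmul_eq_mul, Complex.ext_iff]
  constructor
  · rintro ⟨⟨m, hm⟩, n, hn⟩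
    exact ⟨m, n, hm.symm, hn.symm⟩
  · rintro ⟨m, n, hm, hn⟩
    exact ⟨⟨m, hm.symm⟩, n, hn.symm⟩

theorem toTorus_add_re (a : ℝ) (z : ℂ) : toTorus a ⟨z.re + a, z.im⟩ = toTorus a z := by
  rw [← sub_eq_zero, ← map_sub, toTorus_eq_zero_iff]
  exact ⟨1, 0, by apply Complex.ext <;> simp⟩

theorem toTorus_add_im (a : ℝ) (z : ℂ) : toTorus a ⟨z.re, z.im + a⟩ = toTorus a z := by
  rw [← sub_eq_zero, ← map_sub, toTorus_eq_zero_iff]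
  exact ⟨0, 1, by apply Complex.ext <;> simp⟩

/-! ### The projection of a square-tiled surface to the torus. -/

namespace TranslationSurface.SquareTiling

variable {X : Type*} [TopologicalSpace X] {S : TranslationSurface X} (T : S.SquareTiling)

/-- The closed square that parametrizes the tiles. -/
def square : Set ℂ := Set.Icc 0 T.side ×ℂ Set.Icc 0 T.side

variable {T}

theorem mem_square {z : ℂ} :
    z ∈ T.square ↔ (0 ≤ z.re ∧ z.re ≤ T.side) ∧ 0 ≤ z.im ∧ z.im ≤ T.side := Iff.rfl

theorem eventually_add_mem {z : ℂ} {i : Fin T.count} (hz : z ∈ T.square)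
    {φ : OpenPartialHomeomorph X ℂ} (hφ : φ ∈ S.atlas) (h : T.tile i z ∈ φ.source) :
    ∀ᶠ u in 𝓝 (0 : ℂ), z + u ∈ T.square →
      T.tile i (z + u) ∈ φ.source ∧ φ (T.tile i (z + u)) = φ (T.tile i z) + u := by
  have h1 := T.translation i z hz φ hφ h
  have h2 := (T.continuousOn i z hz).eventually (φ.open_source.mem_nhds h)
  have h3 := (h1.and h2)
  rw [eventually_nhdsWithin_iff] at h3
  have h4 : Tendsto (fun u : ℂ => z + u) (𝓝 0) (𝓝 z) := by
    have : Tendsto (fun u : ℂ => z + u) (𝓝 0) (𝓝 (z + 0)) := Continuous.tendsto (by fun_prop) 0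
    rwa [add_zero] at this
  filter_upwards [h4.eventually h3] with u hu hm
  obtain ⟨h5, h6⟩ := hu hm
  refine ⟨h6, ?_⟩
  rw [sub_eq_iff_eq_add.1 h5]
  ring

/-- Off the vertices a point is interior to a square or interior to a side. In the latter case the
glued neighbour supplies the other half disc; in the former both pairs coincide. -/
theorem exists_pair {z : ℂ} {i : Fin T.count} (hz : z ∈ T.square)
    (hn : ¬ ((z.re = 0 ∨ z.re = T.side) ∧ (z.im = 0 ∨ z.im = T.side))) :
    ∃ p p' : Fin T.count × ℂ, (p.2 ∈ T.square ∧ T.tile p.1 p.2 = T.tile i z ∧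
        toTorus T.side p.2 = toTorus T.side z) ∧
      (p'.2 ∈ T.square ∧ T.tile p'.1 p'.2 = T.tile i z ∧
        toTorus T.side p'.2 = toTorus T.side z) ∧
      ∀ᶠ u in 𝓝 (0 : ℂ), p.2 + u ∈ T.square ∨ p'.2 + u ∈ T.square := by
  have ha := T.side_pos
  obtain ⟨⟨h0, h1⟩, h2, h3⟩ := mem_square.1 hz
  have hre : ∀ c : ℝ, 0 < c → ∀ᶠ u in 𝓝 (0 : ℂ), |u.re| < c := fun c hc => by
    have : ContinuousAt (fun u : ℂ => |u.re|) 0 := by fun_prop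
    exact this.eventually_lt continuousAt_const (by simpa using hc)
  have him : ∀ c : ℝ, 0 < c → ∀ᶠ u in 𝓝 (0 : ℂ), |u.im| < c := fun c hc => by
    have : ContinuousAt (fun u : ℂ => |u.im|) 0 := by fun_prop
    exact this.eventually_lt continuousAt_const (by simpa using hc)
  have hsame : z ∈ T.square ∧ T.tile i z = T.tile i z ∧ toTorus T.side z = toTorus T.side z :=
    ⟨hz, rfl, rfl⟩
  simp only [mem_square, Complex.add_re, Complex.add_im]
  rcases h0.eq_or_lt with h0 | h0
  · have h2' : 0 < z.im := lt_of_le_of_ne h2 fun h => hn ⟨Or.inl h0.symm, Or.inl h.symm⟩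
    have h3' : z.im < T.side := lt_of_le_of_ne h3 fun h => hn ⟨Or.inl h0.symm, Or.inr h⟩
    refine ⟨(i, z), (T.right⁻¹ i, ⟨T.side, z.im⟩), hsame, ⟨?_, ?_, ?_⟩, ?_⟩
    · exact ⟨⟨ha.le, le_rfl⟩, h2, h3⟩
    · rw [T.glue_right _ _ ⟨h2, h3⟩]
      rw [show T.right (T.right⁻¹ i) = i from T.right.apply_symm_apply i]
      congr 1
      exact Complex.ext h0 rfl
    · rw [← toTorus_add_re T.side z, ← h0, zero_add]
    · filter_upwards [hre _ ha, him _ h2', him _ (sub_pos.2 h3')] with u h4 h5 h6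
      rw [abs_lt] at h4 h5 h6
      rcases le_total 0 u.re with h | h
      · left; refine ⟨⟨?_, ?_⟩, ?_, ?_⟩ <;> linarith
      · right; refine ⟨⟨?_, ?_⟩, ?_, ?_⟩ <;> linarith
  rcases h1.eq_or_lt with h1 | h1
  · have h2' : 0 < z.im := lt_of_le_of_ne h2 fun h => hn ⟨Or.inr h1, Or.inl h.symm⟩
    have h3' : z.im < T.side := lt_of_le_of_ne h3 fun h => hn ⟨Or.inr h1, Or.inr h⟩
    refine ⟨(i, z), (T.right i, ⟨0, z.im⟩), hsame, ⟨?_, ?_, ?_⟩, ?_⟩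
    · exact ⟨⟨le_rfl, ha.le⟩, h2, h3⟩
    · rw [← T.glue_right _ _ ⟨h2, h3⟩]
      congr 1
      exact Complex.ext h1.symm rfl
    · rw [← toTorus_add_re T.side ⟨0, z.im⟩]
      simp [← h1]
    · filter_upwards [hre _ ha, him _ h2', him _ (sub_pos.2 h3')] with u h4 h5 h6
      rw [abs_lt] at h4 h5 h6
      rcases le_total u.re 0 with h | h
      · left; refine ⟨⟨?_, ?_⟩, ?_, ?_⟩ <;> linarith
      · right; refine ⟨⟨?_, ?_⟩, ?_, ?_⟩ <;> linarith
  rcases h2.eq_or_lt with h2 | h2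
  · refine ⟨(i, z), (T.up⁻¹ i, ⟨z.re, T.side⟩), hsame, ⟨?_, ?_, ?_⟩, ?_⟩
    · exact ⟨⟨h0.le, h1.le⟩, ha.le, le_rfl⟩
    · rw [T.glue_up _ _ ⟨h0.le, h1.le⟩]
      rw [show T.up (T.up⁻¹ i) = i from T.up.apply_symm_apply i]
      congr 1
      exact Complex.ext rfl h2
    · rw [← toTorus_add_im T.side z, ← h2, zero_add]
    · filter_upwards [him _ ha, hre _ h0, hre _ (sub_pos.2 h1)] with u h4 h5 h6
      rw [abs_lt] at h4 h5 h6
      rcases le_total 0 u.im with h | h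
      · left; refine ⟨⟨?_, ?_⟩, ?_, ?_⟩ <;> linarith
      · right; refine ⟨⟨?_, ?_⟩, ?_, ?_⟩ <;> linarith
  rcases h3.eq_or_lt with h3 | h3
  · refine ⟨(i, z), (T.up i, ⟨z.re, 0⟩), hsame, ⟨?_, ?_, ?_⟩, ?_⟩
    · exact ⟨⟨h0.le, h1.le⟩, le_rfl, ha.le⟩
    · rw [← T.glue_up _ _ ⟨h0.le, h1.le⟩]
      congr 1
      exact Complex.ext rfl h3.symm
    · rw [← toTorus_add_im T.side ⟨z.re, 0⟩]
      simp [← h3]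
    · filter_upwards [him _ ha, hre _ h0, hre _ (sub_pos.2 h1)] with u h4 h5 h6
      rw [abs_lt] at h4 h5 h6
      rcases le_total u.im 0 with h | h
      · left; refine ⟨⟨?_, ?_⟩, ?_, ?_⟩ <;> linarith
      · right; refine ⟨⟨?_, ?_⟩, ?_, ?_⟩ <;> linarith
  · refine ⟨(i, z), (i, z), hsame, hsame, ?_⟩
    filter_upwards [him _ h2, him _ (sub_pos.2 h3), hre _ h0, hre _ (sub_pos.2 h1)] with u h4 h5 h6 h7
    rw [abs_lt] at h4 h5 h6 h7
    left; refine ⟨⟨?_, ?_⟩, ?_, ?_⟩ <;> linarith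

/-- The tiles cover a neighbourhood of a regular point. -/
theorem eventually_exists_tile {z : ℂ} {i : Fin T.count} (hz : z ∈ T.square)
    {φ : OpenPartialHomeomorph X ℂ} (hφ : φ ∈ S.atlas) (h : T.tile i z ∈ φ.source) :
    ∀ᶠ u in 𝓝 (0 : ℂ), ∃ j, ∃ w ∈ T.square, toTorus T.side w = toTorus T.side z + toTorus T.side u ∧
      T.tile j w ∈ φ.source ∧ φ (T.tile j w) = φ (T.tile i z) + u := by
  have hn : ¬ ((z.re = 0 ∨ z.re = T.side) ∧ (z.im = 0 ∨ z.im = T.side)) := by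
    rw [← T.vertex_iff i z hz]
    exact S.source_subset φ hφ h
  obtain ⟨p, p', ⟨h1, h2, h3⟩, ⟨h1', h2', h3'⟩, h4⟩ := exists_pair hz hn
  have h5 := eventually_add_mem h1 hφ (by rwa [h2])
  have h5' := eventually_add_mem h1' hφ (by rwa [h2'])
  filter_upwards [h4, h5, h5'] with u h6 h7 h8
  rcases h6 with h6 | h6
  · exact ⟨p.1, p.2 + u, h6, by rw [map_add, h3], (h7 h6).1, by rw [(h7 h6).2, h2]⟩
  · exact ⟨p'.1, p'.2 + u, h6, by rw [map_add, h3'], (h8 h6).1, by rw [(h8 h6).2, h2']⟩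

theorem toTorus_eq_zero_iff_vertex {z : ℂ} (hz : z ∈ T.square) :
    toTorus T.side z = 0 ↔ (z.re = 0 ∨ z.re = T.side) ∧ (z.im = 0 ∨ z.im = T.side) := by
  have ha := T.side_pos
  have key : ∀ t : ℝ, 0 ≤ t → t ≤ T.side → ((∃ m : ℤ, t = m * T.side) ↔ t = 0 ∨ t = T.side) := by
    intro t h0 h1
    constructor
    · rintro ⟨m, rfl⟩
      have h2 : (0 : ℝ) ≤ m := nonneg_of_mul_nonneg_left h0 ha
      have h3 : (m : ℝ) ≤ 1 := by
        by_contra! h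
        nlinarith
      have h4 : 0 ≤ m := by exact_mod_cast h2
      have h5 : m ≤ 1 := by exact_mod_cast h3
      obtain rfl | rfl : m = 0 ∨ m = 1 := by omega
      · simp
      · simp
    · rintro (rfl | rfl)
      · exact ⟨0, by simp⟩
      · exact ⟨1, by simp⟩
  rw [toTorus_eq_zero_iff, ← key _ hz.1.1 hz.1.2, ← key _ hz.2.1 hz.2.2]
  simp only [Complex.ext_iff, exists_and_left, exists_and_right]

/-- The tiling controls coincidences only for interior points, so `w` is pushed slightly towards the
centre of its square. The tiles around `z` reach the same displaced point with the same torus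
displacement, and injectivity on the interior identifies the two parameters; the displacement then
cancels. Vertices all map to `0`. -/
theorem toTorus_eq_of_tile_eq {z w : ℂ} {i j : Fin T.count} (hz : z ∈ T.square) (hw : w ∈ T.square)
    (h : T.tile i z = T.tile j w) : toTorus T.side z = toTorus T.side w := by
  have ha := T.side_pos
  by_cases hs : T.tile i z ∈ S.sing
  · rw [(toTorus_eq_zero_iff_vertex hz).2 ((T.vertex_iff i z hz).1 hs),
      (toTorus_eq_zero_iff_vertex hw).2 ((T.vertex_iff j w hw).1 (h ▸ hs))]
  obtain ⟨φ, hφ, hx⟩ := S.cover _ hs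
  have h1 := eventually_exists_tile hz hφ hx
  have h2 := eventually_add_mem hw hφ (by rwa [← h])
  set c : ℂ := ⟨T.side / 2, T.side / 2⟩ with hc
  have h3 : Tendsto (fun t : ℝ => (t : ℂ) * (c - w)) (𝓝[>] 0) (𝓝 0) := by
    have : Tendsto (fun t : ℝ => (t : ℂ) * (c - w)) (𝓝 0) (𝓝 ((0 : ℝ) * (c - w))) :=
      Continuous.tendsto (by fun_prop) 0
    rw [Complex.ofReal_zero, zero_mul] at this
    exact this.mono_left nhdsWithin_le_nhds
  obtain ⟨t, ⟨h4, h5⟩, h6⟩ := ((h3.eventually (h1.and h2)).and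
    (Ioo_mem_nhdsGT (zero_lt_one' ℝ))).exists
  obtain ⟨⟨w0, w1⟩, w2, w3⟩ := mem_square.1 hw
  have h7 : w + t * (c - w) ∈ Set.Ioo 0 T.side ×ℂ Set.Ioo 0 T.side := by
    have key : ∀ b : ℝ, 0 ≤ b → b ≤ T.side → b + t * (T.side / 2 - b) ∈ Set.Ioo 0 T.side := by
      intro b h0 h1
      have h8 : 0 < t * (T.side / 2) := mul_pos h6.1 (by linarith)
      have h9 : 0 ≤ (1 - t) * b := mul_nonneg (by linarith [h6.2]) h0
      have h10 : 0 ≤ (1 - t) * (T.side - b) := mul_nonneg (by linarith [h6.2]) (by linarith)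
      constructor <;> nlinarith
    refine ⟨?_, ?_⟩
    · simpa [hc] using key _ w0 w1
    · simpa [hc] using key _ w2 w3
  obtain ⟨i', z', hz', hq, hs', hφ'⟩ := h4
  obtain ⟨h8, h9⟩ := h5 ⟨⟨h7.1.1.le, h7.1.2.le⟩, h7.2.1.le, h7.2.2.le⟩
  have h10 : T.tile j (w + t * (c - w)) = T.tile i' z' := φ.injOn h8 hs' (by rw [h9, hφ', h])
  obtain ⟨-, h11⟩ := T.injective _ _ _ h7 _ hz' h10
  rw [← h11, map_add] at hq
  exact (add_right_cancel hq).symm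

variable (T)

/-- The projection of a square-tiled surface to the torus. -/
noncomputable def proj (x : X) : AddCircle T.side × AddCircle T.side :=
  toTorus T.side (T.cover x).choose_spec.choose

variable {T}

theorem proj_tile {z : ℂ} (hz : z ∈ T.square) (i : Fin T.count) :
    T.proj (T.tile i z) = toTorus T.side z :=
  toTorus_eq_of_tile_eq (T.cover (T.tile i z)).choose_spec.choose_spec.1 hz
    (T.cover (T.tile i z)).choose_spec.choose_spec.2

theorem isCompact_square : IsCompact T.square := isCompact_Icc.reProdIm isCompact_Icc

/-- The map is defined by a choice of tile, so continuity is read from preimages of closed sets: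
finite unions of images of compact subsets of the square. -/
theorem continuous_proj : Continuous T.proj := by
  have := S.hausdorff
  rw [continuous_iff_isClosed]
  intro F hF
  have h : T.proj ⁻¹' F = ⋃ i, T.tile i '' (T.square ∩ toTorus T.side ⁻¹' F) := by
    ext x
    simp only [Set.mem_preimage, Set.mem_iUnion, Set.mem_image, Set.mem_inter_iff]
    constructor
    · intro hx
      obtain ⟨i, z, hz, rfl⟩ := T.cover x
      exact ⟨i, z, ⟨hz, by rwa [← proj_tile hz i]⟩, rfl⟩
    · rintro ⟨i, z, ⟨hz, hF⟩, rfl⟩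
      rwa [proj_tile hz i]
  rw [h]
  refine isClosed_iUnion_of_finite fun i => ?_
  have hc : IsCompact (T.square ∩ toTorus T.side ⁻¹' F) :=
    isCompact_square.inter_right (hF.preimage (isLocalHomeomorph_toTorus _).continuous)
  exact (hc.image_of_continuousOn ((T.continuousOn i).mono Set.inter_subset_left)).isClosed

variable (T)

/-- A square-tiled surface, branched over the vertices, covers the torus. -/
noncomputable def torusCover : TorusCover S (AddCircle T.side × AddCircle T.side) where
  q := toTorus T.side
  isLocalHomeomorph_q := isLocalHomeomorph_toTorus _
  proj := T.proj
  continuous_proj := continuous_proj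
  proj_eq_zero_iff x := by
    obtain ⟨i, z, hz, rfl⟩ := T.cover x
    rw [proj_tile hz, T.vertex_iff i z hz, toTorus_eq_zero_iff_vertex hz]
  proj_sub φ hφ x hx := by
    obtain ⟨i, z, hz, rfl⟩ := T.cover x
    have h1 : Tendsto (fun y => φ y - φ (T.tile i z)) (𝓝 (T.tile i z)) (𝓝 0) := by
      simpa using (φ.continuousAt hx).tendsto.sub_const (φ (T.tile i z))
    filter_upwards [h1.eventually (eventually_exists_tile hz hφ hx),
      φ.open_source.mem_nhds hx] with y hy hys
    obtain ⟨j, w, hw, hq, hs, he⟩ := hy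
    have h2 : T.tile j w = y := φ.injOn hs hys (by rw [he]; ring)
    rw [← h2, proj_tile hw, proj_tile hz, hq, h2]
    abel

end TranslationSurface.SquareTiling

/-! ### Linear images, and multiples of primitive vectors. -/

/-- The branched cover, for the surface with charts composed with a linear map. -/
noncomputable def TorusCover.linearImage {X : Type*} [TopologicalSpace X]
    {S : TranslationSurface X} {G : Type*} [AddCommGroup G] [TopologicalSpace G]
    (C : TorusCover S G) (A : Matrix.SpecialLinearGroup (Fin 2) ℝ) :
    TorusCover (S.linearImage A) G where
  q := C.q.comp (planeMap A⁻¹ : ℂ →+ ℂ)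
  isLocalHomeomorph_q :=
    C.isLocalHomeomorph_q.comp (planeMap A⁻¹).toHomeomorph.isLocalHomeomorph
  proj := C.proj
  continuous_proj := C.continuous_proj
  proj_eq_zero_iff := C.proj_eq_zero_iff
  proj_sub := by
    rintro _ ⟨φ, hφ, rfl⟩ x hx
    filter_upwards [C.proj_sub φ hφ x hx] with y hy
    rw [hy]
    have h : ∀ z, planeMap A⁻¹ (planeMap A z) = z := fun z => by
      have := planeMap_inv_apply A⁻¹ z
      rwa [inv_inv] at this
    change _ = C.q (planeMap A⁻¹ (planeMap A (φ y) - planeMap A (φ x)))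
    rw [map_sub (planeMap A⁻¹), h, h]

namespace TorusCover

variable {X : Type*} [TopologicalSpace X] {S : TranslationSurface X}
  {G : Type*} [AddCommGroup G] [TopologicalSpace G] {C : TorusCover S G}

/-- Every nonzero lattice vector is a positive multiple of a unique primitive vector. -/
theorem multiple_bijective :
    Function.Bijective (fun p : {v // C.IsPrimitive v} × ℕ =>
      (⟨(p.2 + 1 : ℕ) • (p.1 : ℂ), by
        refine ⟨smul_ne_zero (by positivity) p.1.2.ne_zero, ?_⟩
        rw [map_nsmul, p.1.2.1, smul_zero]⟩ : {v : ℂ // v ≠ 0 ∧ C.q v = 0})) := by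
  constructor
  · have key : ∀ (v w : {v // C.IsPrimitive v}) (d e : ℕ),
        (d + 1 : ℕ) • (v : ℂ) = (e + 1 : ℕ) • (w : ℂ) → e ≤ d := by
      intro v w d e h
      by_contra! hlt
      -- If `d < e`, this proper fraction of `v` equals the kernel vector `w`, against the
      -- primitivity of `v`.
      refine v.2.2 ((d + 1 : ℝ) / (e + 1)) ?_ ?_
      · have : (d : ℝ) < e := by exact_mod_cast hlt
        refine ⟨by positivity, (div_lt_one (by positivity)).2 (by linarith)⟩
      · have h1 : (((d + 1 : ℝ) / (e + 1) : ℝ) : ℂ) * v = w := by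
          rw [nsmul_eq_mul, nsmul_eq_mul] at h
          have h2 : (((e + 1 : ℕ) : ℂ)) ≠ 0 := Nat.cast_ne_zero.2 e.succ_ne_zero
          have h3 : (w : ℂ) = ((d + 1 : ℕ) : ℂ) * v / ((e + 1 : ℕ) : ℂ) := by
            rw [h]
            field_simp
          rw [h3]
          push_cast
          ring
        rw [h1, w.2.1]
    rintro ⟨v, d⟩ ⟨w, e⟩ h
    have h := congrArg Subtype.val h
    simp only at h
    obtain rfl := le_antisymm (key w v e d h.symm) (key v w d e h)
    rw [Prod.mk.injEq]
    exact ⟨Subtype.ext (smul_right_injective ℂ (by positivity : (d + 1 : ℕ) ≠ 0) h), rfl⟩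
  · rintro ⟨v, hv0, hv⟩
    -- The real multiples of `v` in the kernel are isolated at `0`, because `q` is injective there.
    -- So they form a cyclic group, and its positive generator `c` gives the primitive vector `c *
    -- v`.
    let H : AddSubgroup ℝ :=
      { carrier := {t | C.q (t * v) = 0}
        zero_mem' := by simp
        add_mem' := fun {a b} ha hb => by
          change C.q (((a + b : ℝ) : ℂ) * v) = 0
          rw [Complex.ofReal_add, add_mul, map_add, ha, hb, add_zero]
        neg_mem' := fun {a} ha => by
          change C.q (((-a : ℝ) : ℂ) * v) = 0
          rw [Complex.ofReal_neg, neg_mul, map_neg, ha, neg_zero] }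
    have hH : ∀ t, t ∈ H ↔ C.q (t * v) = 0 := fun t => Iff.rfl
    have hn : 0 < ‖v‖ := norm_pos_iff.2 hv0
    obtain ⟨b, hb⟩ := AddSubgroup.cyclic_of_isolated_zero (H := H)
      (div_pos C.radius_pos hn) (by
        rw [Set.disjoint_left]
        rintro t ht ⟨h0, h1⟩
        have h2 : (t : ℂ) * v = 0 := by
          refine C.eq_of_q_eq ?_ (by simpa using C.radius_pos) (by rw [map_zero]; exact ht)
          rw [norm_mul, Complex.norm_real, Real.norm_of_nonneg h0.le]
          exact (lt_div_iff₀ hn).1 h1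
        rcases mul_eq_zero.1 h2 with h | h
        · exact h0.ne' (by exact_mod_cast h)
        · exact hv0 h)
    obtain ⟨c, hc0, hc⟩ : ∃ c : ℝ, 0 ≤ c ∧ ∀ t, t ∈ H ↔ ∃ m : ℤ, (m : ℝ) * c = t := by
      rcases le_total 0 b with h | h
      · refine ⟨b, h, fun t => ?_⟩
        rw [hb, AddSubgroup.mem_closure_singleton]
        simp
      · refine ⟨-b, by linarith, fun t => ?_⟩
        rw [hb, AddSubgroup.mem_closure_singleton]
        constructor
        · rintro ⟨m, rfl⟩
          exact ⟨-m, by simp⟩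
        · rintro ⟨m, rfl⟩
          exact ⟨-m, by simp⟩
    obtain ⟨m, hm⟩ := (hc 1).1 (by rw [hH]; simpa using hv)
    have hc0 : 0 < c := lt_of_le_of_ne hc0 (by rintro rfl; simp at hm)
    have hm0 : 0 < m := by
      have : (0 : ℝ) < m := by
        by_contra! h
        nlinarith
      exact_mod_cast this
    -- The multiplicity is positive, so it is stored as `d + 1`.
    obtain ⟨d, rfl⟩ : ∃ d : ℕ, m = (d + 1 : ℕ) := ⟨(m - 1).toNat, by omega⟩
    refine ⟨⟨⟨c * v, (hH c).1 ((hc c).2 ⟨1, by simp⟩), ?_⟩, d⟩, ?_⟩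
    · intro t ht h0
      have h1 : t * c ∈ H := by
        rw [hH, ← h0]
        push_cast
        ring_nf
      obtain ⟨e, he⟩ := (hc _).1 h1
      have h2 : (e : ℝ) = t := mul_right_cancel₀ hc0.ne' he
      rw [← h2] at ht
      have h3 : 0 < e := by exact_mod_cast ht.1
      have h4 : e < 1 := by exact_mod_cast ht.2
      omega
    · apply Subtype.ext
      simp only [nsmul_eq_mul]
      rw [← mul_assoc]
      have : (((d + 1 : ℕ) : ℂ)) * c = 1 := by exact_mod_cast hm
      rw [this, one_mul]

end TorusCover

/-! ### Counting the squares by their diagonals. -/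

namespace TranslationSurface.SquareTiling

variable {X : Type*} [TopologicalSpace X] {S : TranslationSurface X} (T : S.SquareTiling)

/-- The diagonal of the squares. -/
noncomputable def diagonal : ℂ := ⟨T.side, T.side⟩

theorem mul_diagonal (t : ℝ) : (t : ℂ) * T.diagonal = ⟨t * T.side, t * T.side⟩ := by
  apply Complex.ext <;> simp [diagonal]

theorem mul_diagonal_mem {t : ℝ} (ht : t ∈ Set.Icc (0 : ℝ) 1) : (t : ℂ) * T.diagonal ∈ T.square := by
  have ha := T.side_pos
  rw [mul_diagonal]
  have : t * T.side ∈ Set.Icc 0 T.side := ⟨mul_nonneg ht.1 ha.le, by nlinarith [ht.2]⟩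
  exact ⟨this, this⟩

theorem mul_diagonal_mem_interior {t : ℝ} (ht : t ∈ Set.Ioo (0 : ℝ) 1) :
    (t : ℂ) * T.diagonal ∈ Set.Ioo 0 T.side ×ℂ Set.Ioo 0 T.side := by
  have ha := T.side_pos
  rw [mul_diagonal]
  have : t * T.side ∈ Set.Ioo 0 T.side := ⟨mul_pos ht.1 ha, by nlinarith [ht.2]⟩
  exact ⟨this, this⟩

/-- The diagonal of a tile. -/
noncomputable def tileDiagonal (i : Fin T.count) : S.SaddleConnection where
  path := ⟨fun u => T.tile i ((u : ℝ) * T.diagonal),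
    (T.continuousOn i).comp_continuous (by fun_prop) fun u => T.mul_diagonal_mem u.2⟩
  hol := T.diagonal
  hol_ne_zero := fun h => T.side_pos.ne' (congrArg Complex.re h)
  initial_mem := by
    change T.tile i (((0 : unitInterval) : ℝ) * T.diagonal) ∈ S.sing
    rw [T.vertex_iff i _ (T.mul_diagonal_mem (0 : unitInterval).2)]
    simp
  terminal_mem := by
    change T.tile i (((1 : unitInterval) : ℝ) * T.diagonal) ∈ S.sing
    rw [T.vertex_iff i _ (T.mul_diagonal_mem (1 : unitInterval).2)]
    simp [diagonal]
  interior u h0 h1 := by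
    change T.tile i ((u : ℝ) * T.diagonal) ∉ S.sing
    rw [T.vertex_iff i _ (T.mul_diagonal_mem u.2)]
    have h := T.mul_diagonal_mem_interior (t := u) ⟨h0, h1⟩
    rintro ⟨h2 | h2, -⟩
    · exact h.1.1.ne' h2
    · exact h.1.2.ne h2
  straight u h0 h1 φ hφ hu := by
    have h := T.translation i _ (T.mul_diagonal_mem u.2) φ hφ hu
    have h2 : Tendsto (fun w : unitInterval => ((w : ℝ) : ℂ) * T.diagonal) (𝓝 u)
        (𝓝[T.square] ((u : ℝ) * T.diagonal)) :=
      tendsto_nhdsWithin_iff.2 ⟨Continuous.tendsto (by fun_prop) u,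
        Eventually.of_forall fun w => T.mul_diagonal_mem w.2⟩
    filter_upwards [h2.eventually h] with w hw
    simp only [ContinuousMap.coe_mk]
    rw [hw]
    push_cast
    ring

theorem isPrimitive_diagonal : T.torusCover.IsPrimitive T.diagonal := by
  constructor
  · exact toTorus_eq_zero_iff.2 ⟨1, 1, by simp [diagonal]⟩
  · intro t ht h
    have h1 := (toTorus_eq_zero_iff_vertex (T.mul_diagonal_mem ⟨ht.1.le, ht.2.le⟩)).1 h
    have h2 := T.mul_diagonal_mem_interior ht
    rcases h1.1 with h | h
    · exact h2.1.1.ne' h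
    · exact h2.1.2.ne h

/-- The midpoint of such a saddle connection lies over half the diagonal, and the only point of a
closed square in that class is the centre. Agreement with the diagonal of the tile at one interior
point gives equality. -/
theorem tileDiagonal_bijective :
    Function.Bijective (fun i => (⟨T.tileDiagonal i, rfl⟩ :
      {s : S.SaddleConnection // s.hol = T.diagonal})) := by
  have ha := T.side_pos
  have hhalf : (1 / 2 : ℝ) ∈ Set.Ioo (0 : ℝ) 1 := by norm_num
  set u : unitInterval := ⟨1 / 2, hhalf.1.le, hhalf.2.le⟩ with hu
  constructor
  · intro i j h
    have h1 : T.tileDiagonal i = T.tileDiagonal j := congrArg Subtype.val h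
    have h2 : (T.tileDiagonal i).path u = (T.tileDiagonal j).path u := by rw [h1]
    exact (T.injective i j _ (T.mul_diagonal_mem_interior hhalf) _ (T.mul_diagonal_mem u.2) h2).1
  · rintro ⟨s, hs⟩
    obtain ⟨i, z, hz, hi⟩ := T.cover (s.path u)
    refine ⟨i, Subtype.ext ?_⟩
    have h1 := s.proj_path T.torusCover u
    have h2 : T.torusCover.proj (s.path u) = toTorus T.side z := by
      rw [← hi]
      exact proj_tile hz i
    rw [h2, hs] at h1
    have h3 : z = (u : ℝ) * T.diagonal := by
      have h4 := sub_eq_zero.2 h1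
      change toTorus T.side z - toTorus T.side _ = 0 at h4
      rw [← map_sub, toTorus_eq_zero_iff] at h4
      obtain ⟨m, n, hmn⟩ := h4
      rw [mul_diagonal, Complex.ext_iff] at hmn
      simp only [Complex.sub_re, Complex.sub_im, hu] at hmn
      have key : ∀ (b : ℝ) (m : ℤ), 0 ≤ b → b ≤ T.side → b - 1 / 2 * T.side = m * T.side →
          b = 1 / 2 * T.side := by
        intro b m h0 h1 h2
        have h3 : ((-1 : ℤ) : ℝ) < m := by
          push_cast
          by_contra! h
          nlinarith
        have h4 : (m : ℝ) < (1 : ℤ) := by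
          push_cast
          by_contra! h
          nlinarith
        have h5 : -1 < m := by exact_mod_cast h3
        have h6 : m < 1 := by exact_mod_cast h4
        obtain rfl : m = 0 := by omega
        simp at h2
        linarith
      rw [mul_diagonal]
      exact Complex.ext (key _ m hz.1.1 hz.1.2 hmn.1) (key _ n hz.2.1 hz.2.2 hmn.2)
    refine SaddleConnection.ext_of_path_eq T.torusCover (u := u) hhalf.1 hhalf.2 ?_ hs.symm
    rw [← hi, h3]
    rfl

/-- The number of squares. -/
theorem count_eq {k n : ℕ} (h : S.InStratum k n) : T.count = n * (k + 1) := by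
  obtain ⟨-, -, hn, hcone⟩ := h
  choose! ε P hP using hcone
  set C := T.torusCover
  let v : {v // C.IsPrimitive v} := ⟨T.diagonal, T.isPrimitive_diagonal⟩
  -- The second count of the same saddle connections: with the holonomy fixed, the singular point
  -- and the residue remain free.
  have h1 : Function.Bijective (fun p : S.sing × ZMod (k + 1) =>
      (⟨C.connection hP p.1 p.2 v, C.connection_hol hP _ _ _⟩ :
        {s : S.SaddleConnection // s.hol = T.diagonal})) := by
    constructor
    · rintro ⟨x, j⟩ ⟨y, j'⟩ h
      have h2 := (C.connection_bijective hP).1 (a₁ := (x, j, v)) (a₂ := (y, j', v))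
        (congrArg Subtype.val h)
      simpa using h2
    · rintro ⟨s, hs⟩
      obtain ⟨⟨x, j, w⟩, rfl⟩ := (C.connection_bijective hP).2 s
      have h2 : w = v := Subtype.ext ((C.connection_hol hP _ _ _).symm.trans hs)
      exact ⟨(x, j), Subtype.ext (by simp only [h2])⟩
  have h2 := Nat.card_eq_of_bijective _ T.tileDiagonal_bijective
  have h3 := Nat.card_eq_of_bijective _ h1
  rw [Nat.card_fin] at h2
  rw [h2, ← h3, Nat.card_prod, Nat.card_zmod, Nat.card_coe_set_eq, hn]

end TranslationSurface.SquareTiling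

/-- Area `1` means that the side is `1/√count`, so the kernel of the projection of `A S` is the
image under `A` of the required lattice. -/
theorem latticeImage_eq {X : Type*} [TopologicalSpace X] {S : TranslationSurface X}
    (T : S.SquareTiling) (harea : T.area = 1) (A : Matrix.SpecialLinearGroup (Fin 2) ℝ) :
    latticeImage A T.count = {v | v ≠ 0 ∧ (T.torusCover.linearImage A).q v = 0} := by
  have ha := T.side_pos
  rw [TranslationSurface.SquareTiling.area] at harea
  have hside : T.side = 1 / √(T.count : ℝ) := by
    have h1 : (0 : ℝ) ≤ T.count := by positivity
    have h2 : √(T.count : ℝ) * T.side = 1 := by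
      rw [← Real.sqrt_sq ha.le, ← Real.sqrt_mul h1, harea, Real.sqrt_one]
    rw [eq_div_iff (by rintro h; simp [h] at h2), mul_comm, h2]
  have hdiv : ∀ a : ℤ, (a : ℝ) / √(T.count : ℝ) = a * T.side := fun a => by
    rw [hside]
    ring
  ext v
  have hq : (T.torusCover.linearImage A).q v = 0 ↔
      ∃ m n : ℤ, v = planeMap A ⟨m * T.side, n * T.side⟩ := by
    change toTorus T.side (planeMap A⁻¹ v) = 0 ↔ _
    rw [toTorus_eq_zero_iff]
    have h : ∀ z w, planeMap A⁻¹ z = w ↔ z = planeMap A w := fun z w => by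
      constructor
      · rintro rfl
        exact (planeMap_inv_apply A z).symm
      · rintro rfl
        have := planeMap_inv_apply A⁻¹ w
        rwa [inv_inv] at this
    simp only [h]
  simp only [latticeImage, Set.mem_ofPred_eq, hq, hdiv]
  constructor
  · rintro ⟨a, b, hab, rfl⟩
    refine ⟨?_, a, b, rfl⟩
    rw [(map_ne_zero_iff _ (planeMap A).injective)]
    intro h
    have h1 := congrArg Complex.re h
    have h2 := congrArg Complex.im h
    simp [ha.ne'] at h1 h2
    exact hab (by rw [h1, h2])
  · rintro ⟨h0, m, n, rfl⟩
    refine ⟨m, n, ?_, rfl⟩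
    rintro h
    rw [Prod.mk.injEq] at h
    apply h0
    rw [h.1, h.2]
    have : (⟨((0 : ℤ) : ℝ) * T.side, ((0 : ℤ) : ℝ) * T.side⟩ : ℂ) = 0 := by
      apply Complex.ext <;> simp
    rw [this, map_zero]

/-! ### Lists generated by a function or by a sequence of instructions. -/

namespace List

variable {D : Type*}

theorem iterate_succ_eq_append (f : D → D) (a : D) (n : ℕ) :
    iterate f a (n + 1) = iterate f a n ++ [f^[n] a] := by
  rw [iterate_add]
  rfl

theorem head?_iterate_succ (f : D → D) (a : D) (n : ℕ) :
    (iterate f a (n + 1)).head? = some a := rfl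

theorem getLast?_iterate_succ (f : D → D) (a : D) (n : ℕ) :
    (iterate f a (n + 1)).getLast? = some (f^[n] a) := by
  rw [iterate_succ_eq_append, getLast?_append]
  rfl

theorem isChain_iterate {R : D → D → Prop} {f : D → D} (h : ∀ a, R a (f a)) (a : D) (n : ℕ) :
    (iterate f a n).IsChain R := by
  induction n with
  | zero => exact isChain_nil
  | succ n ih =>
    rw [iterate_succ_eq_append, isChain_append]
    refine ⟨ih, .singleton _, ?_⟩
    cases n with
    | zero => simp [iterate]
    | succ n =>
      rw [getLast?_iterate_succ]
      rintro x hx y hy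
      simp only [Option.mem_def, Option.some.injEq, head?_cons] at hx hy
      rw [← hx, ← hy, Function.iterate_succ_apply']
      exact h _

/-- A chain for a functional relation is an orbit segment, encoded by its head and its length minus
one. -/
theorem exists_iterate_eq {R : D → D → Prop} {f : D → D} (h : ∀ a b, R a b → b = f a) {e : List D}
    (hne : e ≠ []) (he : e.IsChain R) : ∃ p : D × ℕ, iterate f p.1 (p.2 + 1) = e := by
  induction e with
  | nil => exact absurd rfl hne
  | cons a e ih =>
    cases e with
    | nil => exact ⟨(a, 0), rfl⟩
    | cons b e =>
      rw [isChain_cons_cons] at he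
      obtain ⟨⟨b', n⟩, hp⟩ := ih (by simp) he.2
      have hb : b' = b := (cons_eq_cons.1 hp).1
      refine ⟨(a, n + 1), ?_⟩
      rw [iterate, ← h a b he.1, ← hp, hb]

theorem iterate_succ_injective (f : D → D) :
    Function.Injective (fun p : D × ℕ => iterate f p.1 (p.2 + 1)) := by
  rintro ⟨a, n⟩ ⟨b, m⟩ h
  have h1 := congrArg length h
  have h2 := congrArg head? h
  simp only [length_iterate, Nat.add_right_cancel_iff, head?_iterate_succ, Option.some.injEq]
    at h1 h2
  rw [h1, h2]

variable {B Y : Type*} (g : B → Y → B)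

/-- The orbit of `b` under a sequence of instructions. -/
def trail : B → List Y → List B
  | b, [] => [b]
  | b, y :: l => b :: trail (g b y) l

variable {g}

theorem length_trail (b : B) (l : List Y) : (trail g b l).length = l.length + 1 := by
  induction l generalizing b with
  | nil => rfl
  | cons y l ih => simp [trail, ih]

theorem head?_trail (b : B) (l : List Y) : (trail g b l).head? = some b := by
  cases l <;> rfl

theorem map_trail {M : Type*} (H : B → M) (G : Y → M) (h : ∀ b y, H (g b y) = G y) (b : B)
    (l : List Y) : (trail g b l).map H = H b :: l.map G := by
  induction l generalizing b with
  | nil => rfl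
  | cons y l ih => simp [trail, ih, h]

theorem isChain_trail {Q : B → B → Prop} (h : ∀ b y, Q b (g b y)) (b : B) (l : List Y) :
    (trail g b l).IsChain Q := by
  induction l generalizing b with
  | nil => exact .singleton _
  | cons y l ih =>
    rw [trail, isChain_cons, head?_trail]
    exact ⟨fun c hc => by rw [← Option.some.inj hc]; exact h b y, ih _⟩

theorem exists_trail_eq {Q : B → B → Prop} (h : ∀ b c, Q b c → ∃ y, g b y = c) {b : B} {w : List B}
    (hw : (b :: w).IsChain Q) : ∃ l, trail g b l = b :: w := by
  induction w generalizing b with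
  | nil => exact ⟨[], rfl⟩
  | cons c w ih =>
    rw [isChain_cons_cons] at hw
    obtain ⟨y, rfl⟩ := h b c hw.1
    obtain ⟨l, hl⟩ := ih hw.2
    exact ⟨y :: l, by rw [trail, hl]⟩

theorem trail_injective (h : ∀ b, Function.Injective (g b)) {b b' : B} {l l' : List Y}
    (hl : trail g b l = trail g b' l') : b = b' ∧ l = l' := by
  induction l generalizing b b' l' with
  | nil =>
    have h1 := congrArg length hl
    rw [length_trail, length_trail] at h1
    obtain rfl : l' = [] := length_eq_zero_iff.1 (by simpa using h1.symm)
    simpa [trail] using hl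
  | cons y l ih =>
    cases l' with
    | nil =>
      have h1 := congrArg length hl
      simp [length_trail] at h1
    | cons y' l' =>
      simp only [trail, cons.injEq] at hl
      obtain ⟨rfl, hl⟩ := hl
      obtain ⟨h1, rfl⟩ := ih hl
      exact ⟨rfl, by rw [h b h1]⟩

end List

/-! ### Maximal decompositions into straight runs. -/

namespace TranslationSurface

variable {X : Type*} [TopologicalSpace X] {S : TranslationSurface X}

open Classical in
/-- Maximal decompositions are unique. -/
theorem IsMaximalDecomposition.eq_splitBy {p : List S.SaddleConnection}
    {d : List (List S.SaddleConnection)} (h : IsMaximalDecomposition p d) :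
    d = p.splitBy (fun s t => decide (s.HasClockwiseAngle t Real.pi)) := by
  obtain ⟨rfl, h1, h2⟩ := h
  refine (List.splitBy_flatten (fun h => (h1 _ h).1 rfl) (fun e he => by simpa using (h1 e he).2)
    ?_).symm
  -- Both pieces are already singular connections, so their concatenation fails to be one only
  -- because the junction is not straight. The cuts are thus exactly the non-straight junctions.
  refine h2.imp_of_mem_imp fun a b ha hb hab => ⟨(h1 a ha).1, (h1 b hb).1, ?_⟩
  rw [decide_eq_false_iff_not]
  refine fun hc => hab ⟨by simp [(h1 a ha).1], ?_⟩
  rw [List.isChain_append]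
  refine ⟨(h1 a ha).2, (h1 b hb).2, ?_⟩
  rw [List.getLast?_eq_getLast_of_ne_nil (h1 a ha).1, List.head?_eq_some_head (h1 b hb).1]
  rintro x hx y hy
  rw [← Option.some.inj hx, ← Option.some.inj hy]
  exact hc

/-- Hence the uniqueness clause in `pathsWithPieces` is automatic. -/
theorem IsMaximalDecomposition.unique {p : List S.SaddleConnection}
    {d d' : List (List S.SaddleConnection)} (h : IsMaximalDecomposition p d)
    (h' : IsMaximalDecomposition p d') : d' = d := by
  rw [h.eq_splitBy, h'.eq_splitBy]

variable (next : S.SaddleConnection → S.SaddleConnection)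

/-- The singular connection that starts with a saddle connection `b.1` and continues straight
on, through `b.2` further saddle connections. -/
def straightRun (b : S.SaddleConnection × ℕ) : List S.SaddleConnection :=
  List.iterate next b.1 (b.2 + 1)

/-- `c` continues `b` by a geodesic turn that is not straight. -/
def RunTurn (b c : S.SaddleConnection × ℕ) : Prop :=
  (next^[b.2] b.1).GeodesicTurn c.1 ∧ ¬ (next^[b.2] b.1).HasClockwiseAngle c.1 Real.pi

variable {next} (hn : ∀ s t : S.SaddleConnection, s.HasClockwiseAngle t Real.pi ↔ t = next s)
  (hg : ∀ s : S.SaddleConnection, s.GeodesicTurn (next s))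

theorem straightRun_ne_nil (b : S.SaddleConnection × ℕ) : straightRun next b ≠ [] := by
  simp [straightRun]

theorem nil_notMem_map_straightRun (w : List (S.SaddleConnection × ℕ)) :
    [] ∉ w.map (straightRun next) := by
  simp [straightRun_ne_nil]

include hn in
theorem isSingularConnection_straightRun (b : S.SaddleConnection × ℕ) :
    IsSingularConnection (straightRun next b) :=
  ⟨straightRun_ne_nil b, List.isChain_iterate (fun s => (hn s _).2 rfl) _ _⟩

include hn in
theorem isSingularConnection_append_iff (b c : S.SaddleConnection × ℕ) :
    IsSingularConnection (straightRun next b ++ straightRun next c) ↔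
      (next^[b.2] b.1).HasClockwiseAngle c.1 Real.pi := by
  rw [IsSingularConnection, List.isChain_append]
  simp only [ne_eq, List.append_eq_nil_iff, straightRun_ne_nil, false_and, not_false_eq_true,
    (isSingularConnection_straightRun hn _).2, true_and]
  rw [straightRun, straightRun, List.getLast?_iterate_succ, List.head?_iterate_succ]
  simp

include hn in
theorem isMaximalDecomposition_map_straightRun {w : List (S.SaddleConnection × ℕ)}
    (hw : w.IsChain (RunTurn next)) :
    IsMaximalDecomposition (w.map (straightRun next)).flatten (w.map (straightRun next)) := by
  refine ⟨rfl, ?_, ?_⟩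
  · intro e he
    obtain ⟨b, -, rfl⟩ := List.mem_map.1 he
    exact isSingularConnection_straightRun hn b
  · rw [List.isChain_map]
    exact hw.imp fun b c h => by
      rw [isSingularConnection_append_iff hn]
      exact h.2

include hg in
-- Straight turns are geodesic, so only the junctions between runs impose a condition.
theorem isChain_geodesicTurn_flatten_iff (w : List (S.SaddleConnection × ℕ)) :
    (w.map (straightRun next)).flatten.IsChain SaddleConnection.GeodesicTurn ↔
      w.IsChain (fun b c => (next^[b.2] b.1).GeodesicTurn c.1) := by
  rw [List.isChain_flatten (nil_notMem_map_straightRun w), List.isChain_map]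
  have h1 : ∀ e ∈ w.map (straightRun next), e.IsChain SaddleConnection.GeodesicTurn := by
    intro e he
    obtain ⟨b, -, rfl⟩ := List.mem_map.1 he
    exact List.isChain_iterate hg _ _
  rw [and_iff_right h1]
  simp only [straightRun, List.getLast?_iterate_succ, List.head?_iterate_succ, Option.mem_def,
    Option.some.injEq, forall_eq']

include hn hg in
theorem flatten_mem_pathsWithPieces {w : List (S.SaddleConnection × ℕ)} (hne : w ≠ [])
    (hw : w.IsChain (RunTurn next)) :
    (w.map (straightRun next)).flatten ∈ S.pathsWithPieces w.length := by
  have h := isMaximalDecomposition_map_straightRun hn hw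
  refine ⟨⟨?_, (isChain_geodesicTurn_flatten_iff hg w).2 (hw.imp fun _ _ h => h.1)⟩, _, h,
    fun d' hd' => h.unique hd', by simp⟩
  intro h0
  obtain ⟨b, w, rfl⟩ := List.exists_cons_of_ne_nil hne
  simp [straightRun_ne_nil] at h0

include hn hg in
theorem exists_map_straightRun_eq {m : ℕ} {p : List S.SaddleConnection}
    (hp : p ∈ S.pathsWithPieces m) : ∃ w : List (S.SaddleConnection × ℕ),
      w.length = m ∧ w.IsChain (RunTurn next) ∧ (w.map (straightRun next)).flatten = p := by
  obtain ⟨⟨hne, hc⟩, d, ⟨rfl, h1, h2⟩, -, rfl⟩ := hp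
  obtain ⟨w, rfl⟩ : ∃ w : List (S.SaddleConnection × ℕ), w.map (straightRun next) = d := by
    have h3 : d ∈ Set.range (List.map (straightRun next)) := by
      rw [Set.range_list_map]
      exact fun e he => List.exists_iterate_eq (fun s t => (hn s t).1) (h1 e he).1 (h1 e he).2
    exact h3
  refine ⟨w, by simp, ?_, rfl⟩
  rw [isChain_geodesicTurn_flatten_iff hg] at hc
  rw [List.isChain_map] at h2
  simp only [isSingularConnection_append_iff hn] at h2
  rw [List.isChain_iff_getElem] at hc h2 ⊢
  exact fun i hi => ⟨hc i hi, h2 i hi⟩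

include hn in
theorem map_straightRun_flatten_injective {w w' : List (S.SaddleConnection × ℕ)}
    (hw : w.IsChain (RunTurn next)) (hw' : w'.IsChain (RunTurn next))
    (h : (w.map (straightRun next)).flatten = (w'.map (straightRun next)).flatten) : w = w' := by
  have h1 := isMaximalDecomposition_map_straightRun hn hw
  rw [h] at h1
  exact (List.map_injective_iff.2 (List.iterate_succ_injective next)
    (h1.unique (isMaximalDecomposition_map_straightRun hn hw'))).symm

section Holonomy

variable (hh : ∀ s : S.SaddleConnection, (next s).hol = s.hol)
include hh

theorem hol_eq_of_mem_iterate {s t : S.SaddleConnection} {n : ℕ} (h : t ∈ List.iterate next s n) :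
    t.hol = s.hol := by
  obtain ⟨m, -, rfl⟩ := List.mem_iterate.1 h
  clear h
  induction m with
  | zero => rfl
  | succ m ih => rw [Function.iterate_succ_apply', hh, ih]

theorem holonomy_straightRun (b : S.SaddleConnection × ℕ) :
    holonomy (straightRun next b) = (b.2 + 1 : ℕ) • b.1.hol := by
  have h : (straightRun next b).map SaddleConnection.hol = List.replicate (b.2 + 1) b.1.hol := by
    rw [List.eq_replicate_iff]
    refine ⟨by simp [straightRun], fun v hv => ?_⟩
    obtain ⟨t, ht, rfl⟩ := List.mem_map.1 hv
    exact hol_eq_of_mem_iterate hh ht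
  rw [holonomy, h, List.sum_replicate]

/-- All saddle connections of a run have the same holonomy, so the triangle inequality is an
equality. -/
theorem pathLength_straightRun (b : S.SaddleConnection × ℕ) :
    pathLength (straightRun next b) = ‖holonomy (straightRun next b)‖ := by
  have h : (straightRun next b).map SaddleConnection.length =
      List.replicate (b.2 + 1) ‖b.1.hol‖ := by
    rw [List.eq_replicate_iff]
    refine ⟨by simp [straightRun], fun v hv => ?_⟩
    obtain ⟨t, ht, rfl⟩ := List.mem_map.1 hv
    rw [SaddleConnection.length, hol_eq_of_mem_iterate hh ht]
  rw [holonomy_straightRun hh, pathLength, h, List.sum_replicate, nsmul_eq_mul, nsmul_eq_mul,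
    norm_mul, Complex.norm_natCast]

theorem pathLength_flatten_map_straightRun (w : List (S.SaddleConnection × ℕ)) :
    pathLength (w.map (straightRun next)).flatten =
      (w.map fun b => ‖holonomy (straightRun next b)‖).sum := by
  induction w with
  | nil => rfl
  | cons b w ih =>
    rw [pathLength] at ih ⊢
    simp only [List.map_cons, List.flatten_cons, List.map_append, List.sum_append, ih,
      List.sum_cons]
    rw [← pathLength_straightRun hh]
    rfl

end Holonomy

end TranslationSurface

/-- Only cardinality matters, so the labelling of the `k` allowed residues is arbitrary. For `k = 0`
the left side would be infinite. -/
theorem ZMod.nonempty_equiv_ne (k : ℕ) (hk : 1 ≤ k) (c : ZMod (k + 1)) :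
    Nonempty (ZMod k ≃ {j : ZMod (k + 1) // j ≠ c}) := by
  have : NeZero k := ⟨by omega⟩
  refine ⟨Fintype.equivOfCardEq ?_⟩
  rw [ZMod.card, Fintype.card_subtype_compl, ZMod.card, Fintype.card_unique, Nat.add_sub_cancel]

/-! ### The bijection between paths and tuples. -/

namespace TorusCover

variable {X : Type*} [TopologicalSpace X] {S : TranslationSurface X}
  {G : Type*} [AddCommGroup G] [TopologicalSpace G] [IsTopologicalAddGroup G] [T2Space G]

/-- The paths of `m` maximal singular connections, on a surface that covers a torus and all of
whose singular points have cone angle `2π(k+1)`. -/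
theorem exists_pathsWithPieces_equiv (C : TorusCover S G) {k : ℕ} (hk : 1 ≤ k) {ε : X → ℝ}
    {P : X → ℝ × ℝ → X} (hP : ∀ x ∈ S.sing, IsPolarChart S.sing S.atlas x k (ε x) (P x))
    {Λ : Set ℂ} (hΛ : Λ = {v | v ≠ 0 ∧ C.q v = 0}) (m : ℕ) (hm : 1 ≤ m) :
    ∃ Φ : S.pathsWithPieces m ≃ S.sing × (ZMod (k + 1) × Λ) × (Fin (m - 1) → ZMod k × Λ),
      ∀ (p : S.pathsWithPieces m) (x : S.sing) (j₁ : ZMod (k + 1)) (v₁ : Λ)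
        (y : Fin (m - 1) → ZMod k × Λ), Φ p = (x, (j₁, v₁), y) →
          (∀ s ∈ p.1.head?, s.initial = x) ∧
          (∀ d, TranslationSurface.IsMaximalDecomposition p.1 d →
            d.map TranslationSurface.holonomy =
              (v₁ : ℂ) :: List.ofFn (fun i => ((y i).2 : ℂ))) ∧
          TranslationSurface.pathLength p.1 = ‖(v₁ : ℂ)‖ + ∑ i, ‖((y i).2 : ℂ)‖ := by
  obtain ⟨M, hM⟩ : ∃ M : {v // C.IsPrimitive v} × ℕ ≃ Λ,
      ∀ p, (p.2 + 1 : ℕ) • (p.1 : ℂ) = M p := by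
    subst hΛ
    exact ⟨(Equiv.ofBijective _ multiple_bijective).trans
      (Equiv.subtypeEquivRight fun v => Iff.rfl), fun p => rfl⟩
  choose next hn hh hg using C.exists_next hP
  choose c hc using exists_turn_iff (C := C) hP
  -- The excluded residue depends on the last saddle connection and the next primitive vector, so
  -- one labelling is fixed for each possible excluded residue.
  let ι : ∀ z : ZMod (k + 1), ZMod k ≃ {j : ZMod (k + 1) // j ≠ z} :=
    fun z => (ZMod.nonempty_equiv_ne k hk z).some
  replace hM : ∀ v, ((M.symm v).2 + 1 : ℕ) • ((M.symm v).1 : ℂ) = v := fun v => by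
    rw [hM, M.apply_symm_apply]
  let first : S.sing → ZMod (k + 1) × Λ → S.SaddleConnection × ℕ :=
    fun x a => (C.connection hP x a.1 (M.symm a.2).1, (M.symm a.2).2)
  -- The next block starts where the last saddle connection of the current one ends, and its residue
  -- avoids the excluded one.
  let g : S.SaddleConnection × ℕ → ZMod k × Λ →
      S.SaddleConnection × ℕ := fun b a =>
    first ⟨(next^[b.2] b.1).terminal, (next^[b.2] b.1).terminal_mem⟩
      ((ι (c (next^[b.2] b.1) (M.symm a.2).1) a.1).1, a.2)
  have hfirst : ∀ x a, TranslationSurface.holonomy (TranslationSurface.straightRun next (first x a))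
      = a.2 := fun x a => by
    rw [TranslationSurface.holonomy_straightRun hh, C.connection_hol hP, hM]
  have hfirst_inj : ∀ x x' a a', first x a = first x' a' → x = x' ∧ a = a' := by
    intro x x' a a' h
    simp only [first, Prod.mk.injEq] at h
    have h1 := (C.connection_bijective hP).1 (a₁ := (x, a.1, (M.symm a.2).1))
      (a₂ := (x', a'.1, (M.symm a'.2).1)) h.1
    simp only [Prod.mk.injEq] at h1
    exact ⟨h1.1, Prod.ext h1.2.1 (M.symm.injective (Prod.ext h1.2.2 h.2))⟩
  have hfirst_surj : ∀ b, ∃ x a, first x a = b := by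
    rintro ⟨s, d⟩
    obtain ⟨⟨x, j, w⟩, rfl⟩ := (C.connection_bijective hP).2 s
    exact ⟨x, (j, M (w, d)), by simp only [first, M.symm_apply_apply]⟩
  have hg_inj : ∀ b, Function.Injective (g b) := by
    rintro b ⟨z, v⟩ ⟨z', v'⟩ h
    have h1 := (hfirst_inj _ _ _ _ h).2
    simp only [Prod.mk.injEq] at h1
    obtain ⟨h2, rfl⟩ := h1
    rw [(ι _).injective (Subtype.ext h2)]
  have hg_turn : ∀ b a, TranslationSurface.RunTurn next b (g b a) := fun b a =>
    (hc _ _ _ _).2 ⟨rfl, (ι _ _).2⟩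
  have hg_surj : ∀ b b', TranslationSurface.RunTurn next b b' → ∃ a, g b a = b' := by
    intro b b' h
    obtain ⟨x, ⟨j, v⟩, rfl⟩ := hfirst_surj b'
    obtain ⟨h1, h2⟩ := (hc _ _ _ _).1 h
    refine ⟨((ι _).symm ⟨j, h2⟩, v), ?_⟩
    simp only [g, Equiv.apply_symm_apply]
    exact congrArg (fun z => first z (j, v)) (Subtype.ext h1)
  -- The `m - 1` instructions produce `m` blocks, since the trail includes its starting block and `1
  -- ≤ m`.
  let word : S.sing × (ZMod (k + 1) × Λ) ×
      (Fin (m - 1) → ZMod k × Λ) → List (S.SaddleConnection × ℕ) :=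
    fun t => List.trail g (first t.1 t.2.1) (List.ofFn t.2.2)
  have hlen : ∀ t, (word t).length = m := fun t => by
    simp only [word, List.length_trail, List.length_ofFn]
    omega
  have hchain : ∀ t, (word t).IsChain (TranslationSurface.RunTurn next) := fun t =>
    List.isChain_trail hg_turn _ _
  have hne : ∀ t, word t ≠ [] := fun t h => by
    have := hlen t
    rw [h] at this
    simp at this
    omega
  let Ψ : S.sing × (ZMod (k + 1) × Λ) ×
      (Fin (m - 1) → ZMod k × Λ) → S.pathsWithPieces m := fun t =>
    ⟨((word t).map (TranslationSurface.straightRun next)).flatten, by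
      have h := TranslationSurface.flatten_mem_pathsWithPieces hn hg (hne t) (hchain t)
      rwa [hlen] at h⟩
  have hΨ : Function.Bijective Ψ := by
    constructor
    · rintro ⟨x, a, y⟩ ⟨x', a', y'⟩ h
      have h1 := TranslationSurface.map_straightRun_flatten_injective hn (hchain _) (hchain _)
        (congrArg Subtype.val h)
      obtain ⟨h2, h3⟩ := List.trail_injective hg_inj h1
      obtain ⟨h4, h5⟩ := hfirst_inj _ _ _ _ h2
      exact Prod.ext h4 (Prod.ext h5 (List.ofFn_injective h3))
    · rintro ⟨p, hp⟩
      obtain ⟨w, hw, hwc, rfl⟩ := TranslationSurface.exists_map_straightRun_eq hn hg hp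
      obtain ⟨b, w, rfl⟩ := List.exists_cons_of_length_pos (by omega : 0 < w.length)
      obtain ⟨l, hl⟩ := List.exists_trail_eq hg_surj hwc
      obtain ⟨x, a, rfl⟩ := hfirst_surj b
      have hll : l.length = m - 1 := by
        have := congrArg List.length hl
        rw [List.length_trail, hw] at this
        omega
      refine ⟨(x, a, fun i => l.get (i.cast hll.symm)), Subtype.ext ?_⟩
      have h2 : List.ofFn (fun i : Fin (m - 1) => l.get (i.cast hll.symm)) = l := by
        rw [← List.ofFn_congr hll, List.ofFn_get]
      simp only [Ψ, word, h2, hl]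
  -- The construction runs from tuples to paths, so the required bijection is its inverse, and its
  -- properties are checked on constructed words.
  refine ⟨(Equiv.ofBijective Ψ hΨ).symm, ?_⟩
  intro p x j v y h
  rw [Equiv.symm_apply_eq] at h
  have hp : p.1 = ((word (x, (j, v), y)).map (TranslationSurface.straightRun next)).flatten :=
    congrArg Subtype.val h
  have hmap : (word (x, (j, v), y)).map
      (fun b => TranslationSurface.holonomy (TranslationSurface.straightRun next b)) =
        (v : ℂ) :: List.ofFn (fun i => ((y i).2 : ℂ)) := by
    have h1 := List.map_trail (g := g)
      (fun b => TranslationSurface.holonomy (TranslationSurface.straightRun next b))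
      (fun a => (a.2 : ℂ)) (fun b a => hfirst _ _) (first x (j, v)) (List.ofFn y)
    rw [hfirst, List.map_ofFn] at h1
    exact h1
  refine ⟨?_, ?_, ?_⟩
  · intro s hs
    obtain ⟨w, hw⟩ := List.head?_eq_some_iff.1 (List.head?_trail (g := g) (first x (j, v)) (List.ofFn y))
    rw [hp] at hs
    simp only [word, hw, List.map_cons, List.flatten_cons] at hs
    rw [List.head?_append_of_ne_nil _ (TranslationSurface.straightRun_ne_nil _)] at hs
    rw [← Option.some.inj hs]
    exact C.connection_initial hP _ _ _
  · intro d hd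
    rw [hp] at hd
    rw [(TranslationSurface.isMaximalDecomposition_map_straightRun hn (hchain _)).unique hd,
      List.map_map]
    exact hmap
  · rw [hp, TranslationSurface.pathLength_flatten_map_straightRun hh]
    have h1 := congrArg (List.map norm) hmap
    rw [List.map_map] at h1
    have h2 := congrArg List.sum h1
    rw [List.map_cons, List.sum_cons, List.map_ofFn, List.sum_ofFn] at h2
    exact h2

end TorusCover

theorem lemma3p1 {X : Type*} [TopologicalSpace X] (X₀ : TranslationSurface X) (k n : ℕ)
    (hstratum : X₀.InStratum k n) (T : X₀.SquareTiling) (harea : T.area = 1)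
    (A : Matrix.SpecialLinearGroup (Fin 2) ℝ) (m : ℕ) (hm : 1 ≤ m) :
    ∃ Φ : (X₀.linearImage A).pathsWithPieces m ≃
        (X₀.linearImage A).sing ×
          (ZMod (k + 1) × latticeImage A (n * (k + 1))) ×
          (Fin (m - 1) → ZMod k × latticeImage A (n * (k + 1))),
      ∀ (p : (X₀.linearImage A).pathsWithPieces m) (x : (X₀.linearImage A).sing)
        (j₁ : ZMod (k + 1)) (v₁ : latticeImage A (n * (k + 1)))
        (y : Fin (m - 1) → ZMod k × latticeImage A (n * (k + 1))),
        Φ p = (x, (j₁, v₁), y) →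
          -- the path starts at `x`
          (∀ s ∈ p.1.head?, s.initial = x) ∧
          -- the vectors are the holonomy vectors of the singular connections, in order
          (∀ d, TranslationSurface.IsMaximalDecomposition p.1 d →
            d.map TranslationSurface.holonomy =
              (v₁ : ℂ) :: List.ofFn (fun i => ((y i).2 : ℂ))) ∧
          -- the length of the path
          TranslationSurface.pathLength p.1 = ‖(v₁ : ℂ)‖ + ∑ i, ‖((y i).2 : ℂ)‖ := by
  have hcone : ∀ x ∈ (X₀.linearImage A).sing, ∃ (ε : ℝ) (P : ℝ × ℝ → X),
      IsPolarChart (X₀.linearImage A).sing (X₀.linearImage A).atlas x k ε P := by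
    intro x hx
    obtain ⟨ε, P, h⟩ := hstratum.2.2.2 x hx
    exact h.linearImage A
  choose! ε P hP using hcone
  refine (T.torusCover.linearImage A).exists_pathsWithPieces_equiv hstratum.1 hP ?_ m hm
  -- The double count of diagonals turns `n(k+1)` into the number of squares, which the area relates
  -- to the side.
  rw [← T.count_eq hstratum]
  exact latticeImage_eq T harea A
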